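/- For $\alpha>0$, $\delta>0$ and $\beta\in\mathbb{C}$ let $$E^{\delta}_{\alpha,\beta}(z)=\sum_{n=0}^{\infty}\frac{(\delta)_n}{n!\,\Gamma(\alpha n+\beta)}z^n,\qquad (\delta)_n=\delta(\delta+1)\cdots(\delta+n-1),\qquad z\in\mathbb{C},$$ be the Prabhakar function (with $1/\Gamma=0$ at the poles of $\Gamma$). For $\epsilon>0$ and $0<\mu<\pi$ let $\gamma(\epsilon,\mu)$ be the contour consisting of the arc $\{|\zeta|=\epsilon,\ |\arg\zeta|\le\mu\}$ and the two rays $\{|\zeta|\ge\epsilon,\ \arg\zeta=\pm\mu\}$, oriented so that $\arg\zeta$ is non-decreasing. Let $G^-(\epsilon,\mu)=\{z:\ |z|<\epsilon\ \text{or}\ |\arg z|>\mu\}$ and $G^+(\epsilon,\mu)=\{z:\ |z|>\epsilon,\ |\arg z|<\mu\}$ be the regions to the left and to the right of it. All powers are principal values (branch cut along the negative real axis, $\arg\in(-\pi,\pi]$), except where another branch is specified below. **Theorem.** Let $\delta>0$, $0<\alpha<2$, $\beta\in\mathbb{C}$, $\epsilon>0$ and $\frac{\pi\alpha}{2}<\mu<\min\{\pi,\alpha\pi\}$,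 and put $g(\zeta)=\exp(\zeta^{1/\alpha})\,\zeta^{\frac{1-\beta}{\alpha}+\delta-1}$. The series defining $E^\delta_{\alpha,\beta}(z)$ converges for every $z\in\mathbb{C}$, and the following hold, all the integrals being absolutely convergent. 1. For every $z\in G^-(\epsilon,\mu)$, $$E^\delta_{\alpha,\beta}(z)=\frac{1}{2\pi\alpha i}\int_{\gamma(\epsilon,\mu)}\frac{\exp(\zeta^{1/\alpha})\,\zeta^{\frac{1-\beta}{\alpha}+\delta-1}}{(\zeta-z)^\delta}\,\mathrm{d}\zeta,$$ where $(\zeta-z)^\delta$ denotes the branch $\zeta^\delta(1-z/\zeta)^\delta$. The same formula holds with the principal value of $(\zeta-z)^\delta$ if $\delta$ is an integer, or if $\zeta-z\notin(-\infty,0]$ for all $\zeta\in\gamma(\epsilon,\mu)$. 2. If $\delta$ is a positive integer, then for every $z\in G^+(\epsilon,\mu)$, $$E^\delta_{\alpha,\beta}(z)=\frac{1}{2\pi\alpha i}\int_{\gamma(\epsilon,\mu)}\frac{\exp(\zeta^{1/\alpha})\,\zeta^{\frac{1-\beta}{\alpha}+\delta-1}}{(\zeta-z)^\delta}\,\mathrm{d}\zeta+\frac{1}{\alpha\,\Gamma(\delta)}\,g^{(\delta-1)}(z).$$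 -/

import Mathlib

noncomputable section

/-- The `n`-th term `(δ)ₙ zⁿ / (n! Γ(α n + β))` of the Prabhakar series. At a pole of `Γ` the
convention `1 / 0 = 0` together with Mathlib's `Γ (-k) = 0` gives the usual value `1 / Γ = 0`. -/
def prabhakarTerm (α β δ z : ℂ) (n : ℕ) : ℂ :=
  (ascPochhammer ℂ n).eval δ / ((n.factorial : ℂ) * Complex.Gamma (α * n + β)) * z ^ n

/-- The Prabhakar generalized Mittag-Leffler function `E^δ_{α,β}(z)`. -/
def prabhakar (α β δ z : ℂ) : ℂ :=
  ∑' n : ℕ, prabhakarTerm α β δ z n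

/-- The set of points of the contour `γ(ε, μ)`: an arc of the circle of radius `ε` and two rays. -/
def contourSet (ε μ : ℝ) : Set ℂ :=
  {ζ | ‖ζ‖ = ε ∧ |ζ.arg| ≤ μ} ∪ {ζ | ε ≤ ‖ζ‖ ∧ |ζ.arg| = μ}

/-- The region `G⁻(ε, μ)` to the left of the contour (it contains the origin). -/
def leftRegion (ε μ : ℝ) : Set ℂ :=
  {z | ‖z‖ < ε ∨ μ < |z.arg|}

/-- The region `G⁺(ε, μ)` to the right of the contour. -/
def rightRegion (ε μ : ℝ) : Set ℂ :=
  {z | ε < ‖z‖ ∧ |z.arg| < μ}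

/-- The point `r e^{iφ}`. -/
def polarPoint (r φ : ℝ) : ℂ :=
  (r : ℂ) * Complex.exp ((φ : ℂ) * Complex.I)

/-- `f` is absolutely integrable along each of the three pieces of `γ(ε, μ)`. -/
def ContourIntegrable (ε μ : ℝ) (f : ℂ → ℂ) : Prop :=
  MeasureTheory.IntegrableOn (fun r : ℝ => f (polarPoint r (-μ))) (Set.Ioi ε) ∧
  IntervalIntegrable (fun φ : ℝ => f (polarPoint ε φ)) MeasureTheory.volume (-μ) μ ∧
  MeasureTheory.IntegrableOn (fun r : ℝ => f (polarPoint r μ)) (Set.Ioi ε)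

/-- The integral of `f` over `γ(ε, μ)`, oriented so that the argument is non-decreasing: inwards
along the ray of argument `-μ`, counterclockwise along the arc, outwards along the ray of
argument `μ`. -/
def contourIntegral (ε μ : ℝ) (f : ℂ → ℂ) : ℂ :=
  -(∫ r in Set.Ioi ε, f (polarPoint r (-μ)) * Complex.exp (((-μ : ℝ) : ℂ) * Complex.I)) +
  (∫ φ in (-μ)..μ, f (polarPoint ε φ) * (Complex.I * polarPoint ε φ)) +
  (∫ r in Set.Ioi ε, f (polarPoint r μ) * Complex.exp ((μ : ℂ) * Complex.I))

/-- The function `g(ζ) = exp(ζ^{1/α}) ζ^{(1-β)/α + δ - 1}`, with principal powers. -/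
def prabhakarG (α δ : ℝ) (β ζ : ℂ) : ℂ :=
  Complex.exp (ζ ^ ((1 / α : ℝ) : ℂ)) * ζ ^ ((1 - β) / (α : ℂ) + (δ : ℂ) - 1)

/-- The branch `ζ^δ (1 - z/ζ)^δ` of `(ζ - z)^δ`, with principal powers on the right. For `z` to the
left of the contour it is continuous in `ζ` along the contour, is holomorphic in `z`, and equals
the principal power `ζ^δ` at `z = 0`. -/
def shiftPow (δ : ℝ) (z ζ : ℂ) : ℂ :=
  ζ ^ (δ : ℂ) * (1 - z / ζ) ^ (δ : ℂ)

end

noncomputable section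

open Complex MeasureTheory Set Filter Topology

/-! ### Holomorphic parameter integrals -/

/-! The bounds on `μ` put `μ / α` between `π/2` and `π`, so `exp(ζ^{1/α})` decays along both rays
faster than any power of `|ζ|`, while `μ < π` keeps the contour off the branch cut. The substitution
`ζ = t^α` turns Hankel's integral into `∫ exp(ζ^{1/α}) ζ^{(1-s)/α - 1} dζ = 2πiα / Γ(s)`
(`contourIntegral_expRootMulCpow`). For `Re s < 1` this follows by shrinking the arc to the origin,
evaluating the two rays as rotated Gamma integrals and applying the reflection formula; both sides
are entire in `s`, which gives the rest.

With the branch `ζ^δ (1 - z/ζ)^δ` the integrand is the kernel for `s = β` times `(1 - z/ζ)^{-δ}`. If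
`|z| < ε`, the binomial series converges uniformly on the contour, and termwise integration with `s
= αn + β` produces the Prabhakar series (`hasSum_prabhakarTerm`). Since `ε` is arbitrary, this also
proves that the series converges everywhere to an entire function. The integral is holomorphic in
`z` on the connected region `G⁻`, so the identity theorem extends the formula from the disc to all
of `G⁻`.

For `z` in `G⁺`, `z` lies to the left of the contour with the larger radius `|z| + 1`. Passing from
that contour to the original one adds the integral over the boundary of an annular sector around
`z`; for integral `δ` Cauchy's formula for derivatives evaluates it (`sectorIntegral_div_sub_pow`).
The principal power agrees with the branch because the discrepancy of the logarithms is continuous,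
takes values in `2πiℤ` and vanishes far out on the contour. -/

theorem tendsto_add_one_div_nhdsNE (p : ℂ) :
    Tendsto (fun n : ℕ => p + ((1 / ((n : ℝ) + 1) : ℝ) : ℂ)) atTop (𝓝[≠] p) := by
  refine tendsto_nhdsWithin_iff.2 ⟨?_, Eventually.of_forall fun n => ?_⟩
  · have h := (continuous_ofReal.tendsto 0).comp tendsto_one_div_add_atTop_nhds_zero_nat
    simpa [Function.comp_def] using (tendsto_const_nhds (x := p)).add h
  · have : ((1 / ((n : ℝ) + 1) : ℝ) : ℂ) ≠ 0 := ofReal_ne_zero.2 (by positivity)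
    simpa using this

/-- Cauchy's estimate converts a local bound on `F` into one on its derivative, so only `F` itself
has to be dominated. -/
theorem differentiableOn_integral_of_locally_dominated {X : Type*} [MeasurableSpace X]
    {ν : Measure X} {U : Set ℂ} (hU : IsOpen U) {F : ℂ → X → ℂ}
    (hmeas : ∀ p ∈ U, AEStronglyMeasurable (F p) ν)
    (hdiff : ∀ᵐ x ∂ν, DifferentiableOn ℂ (fun p => F p x) U)
    (hdom : ∀ p₀ ∈ U, ∃ bound : X → ℝ, Integrable bound ν ∧
      ∃ V ∈ 𝓝 p₀, ∀ᵐ x ∂ν, ∀ p ∈ V, ‖F p x‖ ≤ bound x) :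
    DifferentiableOn ℂ (fun p => ∫ x, F p x ∂ν) U := by
  intro p₀ hp₀
  obtain ⟨bound, hbound, V, hV, hle⟩ := hdom p₀ hp₀
  obtain ⟨r, hr, hrV⟩ := Metric.mem_nhds_iff.1 (inter_mem hV (hU.mem_nhds hp₀))
  -- Since `1/2 + 1/3 < 1`, circles of radius `r/3` about these points stay where both the bound and
  -- holomorphy hold.
  have hVr : ∀ p ∈ Metric.ball p₀ (r / 2), Metric.closedBall p (r / 3) ⊆ V ∩ U := by
    intro p hp
    refine subset_trans (fun q hq => ?_) hrV
    rw [Metric.mem_ball] at hp ⊢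
    rw [Metric.mem_closedBall] at hq
    linarith [dist_triangle q p p₀]
  have hderiv : ∀ᵐ x ∂ν, ∀ p ∈ Metric.ball p₀ (r / 2),
      ‖deriv (fun p => F p x) p‖ ≤ bound x / (r / 3) := by
    filter_upwards [hdiff, hle] with x hx hlex p hp
    refine norm_deriv_le_of_forall_mem_sphere_norm_le (by positivity) ?_ ?_
    · refine (hx.mono ?_).diffContOnCl
      exact (Metric.closure_ball_subset_closedBall).trans ((hVr p hp).trans inter_subset_right)
    · intro q hq
      exact hlex q (hVr p hp (Metric.sphere_subset_closedBall hq)).1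
  have hmeas' : ∀ᶠ p in 𝓝 p₀, AEStronglyMeasurable (F p) ν := by
    filter_upwards [hU.mem_nhds hp₀] with p hp using hmeas p hp
  -- The derivative is measurable as a limit of difference quotients along a sequence; the index is
  -- shifted by `N` so that every point lies in `U`.
  have hd0 : AEStronglyMeasurable (fun x => deriv (fun p => F p x) p₀) ν := by
    have hseq := tendsto_add_one_div_nhdsNE p₀
    have hev : ∀ᶠ n : ℕ in atTop, p₀ + ((1 / ((n : ℝ) + 1) : ℝ) : ℂ) ∈ U :=
      (tendsto_nhds_of_tendsto_nhdsWithin hseq).eventually (hU.mem_nhds hp₀)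
    obtain ⟨N, hN⟩ := eventually_atTop.1 hev
    refine aestronglyMeasurable_of_tendsto_ae atTop
      (f := fun n x => slope (fun p => F p x) p₀ (p₀ + ((1 / (((n + N : ℕ) : ℝ) + 1) : ℝ) : ℂ)))
      (fun n => ?_) ?_
    · simp only [slope_def_field, div_eq_mul_inv]
      exact AEStronglyMeasurable.mul_const
        ((hmeas _ (hN _ (Nat.le_add_left _ _))).sub (hmeas _ hp₀)) _
    · filter_upwards [hdiff] with x hx
      have := ((hx.differentiableAt (hU.mem_nhds hp₀)).hasDerivAt).tendsto_slope.comp hseq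
      exact this.comp (tendsto_add_atTop_nat N)
  have hint : Integrable (F p₀) ν := by
    refine hbound.mono' (hmeas p₀ hp₀) ?_
    filter_upwards [hle] with x hx using hx p₀ (mem_of_mem_nhds hV)
  refine ((hasDerivAt_integral_of_dominated_loc_of_deriv_le (s := Metric.ball p₀ (r / 2))
    (Metric.ball_mem_nhds _ (by positivity)) hmeas' hint hd0 hderiv (hbound.div_const _)
    ?_).2).differentiableAt.differentiableWithinAt
  filter_upwards [hdiff] with x hx p hp
  refine (hx.differentiableAt (hU.mem_nhds ?_)).hasDerivAt
  exact (hVr p hp (Metric.mem_closedBall_self (by positivity))).2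

/-! ### Polar coordinates -/

theorem norm_polarPoint {r : ℝ} (hr : 0 ≤ r) (φ : ℝ) : ‖polarPoint r φ‖ = r := by
  simp [polarPoint, abs_of_nonneg hr]

theorem arg_polarPoint {r φ : ℝ} (hr : 0 < r) (hφ : φ ∈ Ioc (-Real.pi) Real.pi) :
    (polarPoint r φ).arg = φ := by
  rw [polarPoint, arg_real_mul _ hr, exp_mul_I, arg_cos_add_sin_mul_I hφ]

theorem polarPoint_ne_zero {r : ℝ} (hr : 0 < r) (φ : ℝ) : polarPoint r φ ≠ 0 := by
  rw [← norm_pos_iff, norm_polarPoint hr.le]; exact hr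

theorem polarPoint_mem_slitPlane {r φ : ℝ} (hr : 0 < r) (hφ : |φ| < Real.pi) :
    polarPoint r φ ∈ slitPlane := by
  rw [mem_slitPlane_iff_arg, arg_polarPoint hr ⟨(abs_lt.1 hφ).1, (abs_lt.1 hφ).2.le⟩]
  exact ⟨(abs_lt.1 hφ).2.ne, polarPoint_ne_zero hr φ⟩

theorem polarPoint_norm_arg (z : ℂ) : polarPoint ‖z‖ z.arg = z :=
  norm_mul_exp_arg_mul_I z

theorem log_polarPoint {r φ : ℝ} (hr : 0 < r) (hφ : φ ∈ Ioc (-Real.pi) Real.pi) :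
    log (polarPoint r φ) = Real.log r + φ * I := by
  rw [log, norm_polarPoint hr.le, arg_polarPoint hr hφ]

theorem polarPoint_cpow {r φ : ℝ} (hr : 0 < r) (hφ : φ ∈ Ioc (-Real.pi) Real.pi) (c : ℂ) :
    polarPoint r φ ^ c = (r : ℂ) ^ c * exp (φ * I * c) := by
  rw [cpow_def_of_ne_zero (polarPoint_ne_zero hr φ), log_polarPoint hr hφ,
    cpow_def_of_ne_zero (ofReal_ne_zero.2 hr.ne'), ← exp_add, ofReal_log hr.le]
  ring_nf

theorem continuous_polarPoint : Continuous fun p : ℝ × ℝ => polarPoint p.1 p.2 := by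
  unfold polarPoint; fun_prop

theorem hasDerivAt_polarPoint_radius (r φ : ℝ) :
    HasDerivAt (fun r => polarPoint r φ) (exp (φ * I)) r := by
  simpa [polarPoint] using (ofRealCLM.hasDerivAt (x := r)).mul_const (exp (φ * I))

theorem hasDerivAt_polarPoint_angle (r φ : ℝ) :
    HasDerivAt (fun φ => polarPoint r φ) (I * polarPoint r φ) φ := by
  have h : HasDerivAt (fun φ : ℝ => (φ : ℂ) * I) I φ := by
    simpa using (ofRealCLM.hasDerivAt (x := φ)).mul_const I
  have := (h.cexp).const_mul (r : ℂ)
  refine this.congr_deriv ?_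
  simp only [polarPoint]; ring

section

/-! ### Integrals over the boundary of an annular sector -/

/-- The counterclockwise integral over the boundary of `{ε ≤ |ζ| ≤ R, |arg ζ| ≤ μ}`. -/
def sectorIntegral (ε R μ : ℝ) (f : ℂ → ℂ) : ℂ :=
  (∫ r in ε..R, f (polarPoint r (-μ)) * exp (((-μ : ℝ) : ℂ) * I)) +
  (∫ φ in (-μ)..μ, f (polarPoint R φ) * (I * polarPoint R φ)) -
  (∫ r in ε..R, f (polarPoint r μ) * exp ((μ : ℂ) * I)) -
  (∫ φ in (-μ)..μ, f (polarPoint ε φ) * (I * polarPoint ε φ))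

/-- The boundary of the annular sector `{ε ≤ |ζ| ≤ R, |arg ζ| ≤ μ}`. -/
def sectorBoundary (ε R μ : ℝ) : Set ℂ :=
  {ζ | (ε ≤ ‖ζ‖ ∧ ‖ζ‖ ≤ R ∧ |ζ.arg| = μ) ∨ ((‖ζ‖ = ε ∨ ‖ζ‖ = R) ∧ |ζ.arg| ≤ μ)}

theorem polarPoint_arc_mem_sectorBoundary {ε R μ ρ φ : ℝ} (hρ : 0 < ρ) (hρ' : ρ = ε ∨ ρ = R)
    (hμ : μ < Real.pi) (hφ : |φ| ≤ μ) : polarPoint ρ φ ∈ sectorBoundary ε R μ := by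
  have := abs_le.1 hφ
  right
  rw [norm_polarPoint hρ.le, arg_polarPoint hρ ⟨by linarith, by linarith⟩]
  exact ⟨hρ', hφ⟩

theorem polarPoint_ray_mem_sectorBoundary {ε R μ ρ φ : ℝ} (hε : 0 < ε) (hρ : ρ ∈ Icc ε R)
    (hμ : μ < Real.pi) (hφ : |φ| = μ) : polarPoint ρ φ ∈ sectorBoundary ε R μ := by
  have := abs_le.1 hφ.le
  have h0 : 0 < ρ := hε.trans_le hρ.1
  left
  rw [norm_polarPoint h0.le, arg_polarPoint h0 ⟨by linarith, by linarith⟩]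
  exact ⟨hρ.1, hρ.2, hφ⟩

theorem sectorBoundary_subset_slitPlane {ε R μ : ℝ} (hε : 0 < ε) (hεR : ε ≤ R)
    (hμ : μ < Real.pi) : sectorBoundary ε R μ ⊆ slitPlane := by
  intro ζ hζ
  have h1 : ε ≤ ‖ζ‖ ∧ |ζ.arg| ≤ μ := by
    rcases hζ with ⟨h1, -, h2⟩ | ⟨h1 | h1, h2⟩
    · exact ⟨h1, h2.le⟩
    · exact ⟨h1.ge, h2⟩
    · exact ⟨hεR.trans h1.ge, h2⟩
  rw [mem_slitPlane_iff_arg, ← norm_pos_iff]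
  exact ⟨((le_abs_self _).trans_lt (h1.2.trans_lt hμ)).ne, hε.trans_le h1.1⟩

section SectorBoundary

variable {ε R μ : ℝ} {f g : ℂ → ℂ}

theorem continuousOn_arc {ρ a b : ℝ}
    (hf : ∀ φ ∈ uIcc a b, ContinuousAt f (polarPoint ρ φ)) :
    ContinuousOn (fun φ => f (polarPoint ρ φ) * (I * polarPoint ρ φ)) (uIcc a b) := by
  intro φ hφ
  have h := (hasDerivAt_polarPoint_angle ρ φ).continuousAt
  exact (ContinuousAt.mul (ContinuousAt.comp (f := fun φ => polarPoint ρ φ) (hf φ hφ) h)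
    (continuousAt_const.mul h)).continuousWithinAt

theorem continuousOn_ray {φ a b : ℝ}
    (hf : ∀ r ∈ uIcc a b, ContinuousAt f (polarPoint r φ)) :
    ContinuousOn (fun r => f (polarPoint r φ) * exp ((φ : ℂ) * I)) (uIcc a b) := by
  intro r hr
  have h := (hasDerivAt_polarPoint_radius r φ).continuousAt
  exact (ContinuousAt.mul (ContinuousAt.comp (f := fun r => polarPoint r φ) (hf r hr) h)
    continuousAt_const).continuousWithinAt

theorem integral_arc_of_hasDerivAt {F : ℂ → ℂ} {ρ a b : ℝ}
    (hF : ∀ φ ∈ uIcc a b, HasDerivAt F (f (polarPoint ρ φ)) (polarPoint ρ φ))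
    (hf : ∀ φ ∈ uIcc a b, ContinuousAt f (polarPoint ρ φ)) :
    ∫ φ in a..b, f (polarPoint ρ φ) * (I * polarPoint ρ φ) =
      F (polarPoint ρ b) - F (polarPoint ρ a) :=
  intervalIntegral.integral_eq_sub_of_hasDerivAt
    (fun φ hφ => (hF φ hφ).comp φ (hasDerivAt_polarPoint_angle ρ φ))
    (continuousOn_arc hf).intervalIntegrable

theorem integral_ray_of_hasDerivAt {F : ℂ → ℂ} {φ a b : ℝ}
    (hF : ∀ r ∈ uIcc a b, HasDerivAt F (f (polarPoint r φ)) (polarPoint r φ))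
    (hf : ∀ r ∈ uIcc a b, ContinuousAt f (polarPoint r φ)) :
    ∫ r in a..b, f (polarPoint r φ) * exp ((φ : ℂ) * I) =
      F (polarPoint b φ) - F (polarPoint a φ) :=
  intervalIntegral.integral_eq_sub_of_hasDerivAt
    (fun r hr => (hF r hr).comp r (hasDerivAt_polarPoint_radius r φ))
    (continuousOn_ray hf).intervalIntegrable

theorem forall_arc_of_forall_sectorBoundary (hε : 0 < ε) (hεR : ε ≤ R) (hμ0 : 0 ≤ μ)
    (hμ : μ < Real.pi) {p : ℂ → Prop} (hp : ∀ ζ ∈ sectorBoundary ε R μ, p ζ) {ρ : ℝ}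
    (hρ : ρ = ε ∨ ρ = R) : ∀ φ ∈ uIcc (-μ) μ, p (polarPoint ρ φ) := by
  intro φ hφ
  rw [uIcc_of_le (by linarith)] at hφ
  exact hp _ (polarPoint_arc_mem_sectorBoundary (by rcases hρ with rfl | rfl <;> linarith) hρ hμ
    (abs_le.2 hφ))

theorem forall_ray_of_forall_sectorBoundary (hε : 0 < ε) (hεR : ε ≤ R)
    (hμ : μ < Real.pi) {p : ℂ → Prop} (hp : ∀ ζ ∈ sectorBoundary ε R μ, p ζ) {φ : ℝ}
    (hφ : |φ| = μ) : ∀ r ∈ uIcc ε R, p (polarPoint r φ) := by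
  intro r hr
  rw [uIcc_of_le hεR] at hr
  exact hp _ (polarPoint_ray_mem_sectorBoundary hε hr hμ hφ)

theorem sectorIntegral_sub (hε : 0 < ε) (hεR : ε ≤ R) (hμ0 : 0 ≤ μ) (hμ : μ < Real.pi)
    (hf : ∀ ζ ∈ sectorBoundary ε R μ, ContinuousAt f ζ)
    (hg : ∀ ζ ∈ sectorBoundary ε R μ, ContinuousAt g ζ) :
    sectorIntegral ε R μ (fun ζ => f ζ - g ζ) =
      sectorIntegral ε R μ f - sectorIntegral ε R μ g := by
  have arc : ∀ ρ, ρ = ε ∨ ρ = R →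
      ∫ φ in (-μ)..μ, (f (polarPoint ρ φ) - g (polarPoint ρ φ)) * (I * polarPoint ρ φ) =
      (∫ φ in (-μ)..μ, f (polarPoint ρ φ) * (I * polarPoint ρ φ)) -
      ∫ φ in (-μ)..μ, g (polarPoint ρ φ) * (I * polarPoint ρ φ) := by
    intro ρ hρ
    simp only [sub_mul]
    exact intervalIntegral.integral_sub
      (continuousOn_arc (forall_arc_of_forall_sectorBoundary hε hεR hμ0 hμ hf hρ)).intervalIntegrable
      (continuousOn_arc (forall_arc_of_forall_sectorBoundary hε hεR hμ0 hμ hg hρ)).intervalIntegrable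
  have ray : ∀ φ : ℝ, |φ| = μ →
      ∫ r in ε..R, (f (polarPoint r φ) - g (polarPoint r φ)) * exp ((φ : ℂ) * I) =
      (∫ r in ε..R, f (polarPoint r φ) * exp ((φ : ℂ) * I)) -
      ∫ r in ε..R, g (polarPoint r φ) * exp ((φ : ℂ) * I) := by
    intro φ hφ
    simp only [sub_mul]
    exact intervalIntegral.integral_sub
      (continuousOn_ray (forall_ray_of_forall_sectorBoundary hε hεR hμ hf hφ)).intervalIntegrable
      (continuousOn_ray (forall_ray_of_forall_sectorBoundary hε hεR hμ hg hφ)).intervalIntegrable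
  simp only [sectorIntegral]
  rw [arc ε (Or.inl rfl), arc R (Or.inr rfl), ray μ (abs_of_nonneg hμ0),
    ray (-μ) (by rw [abs_neg, abs_of_nonneg hμ0])]
  ring

theorem sectorIntegral_const_mul (c : ℂ) :
    sectorIntegral ε R μ (fun ζ => c * f ζ) = c * sectorIntegral ε R μ f := by
  simp only [sectorIntegral, mul_assoc, intervalIntegral.integral_const_mul]
  ring

theorem sectorIntegral_congr (hε : 0 < ε) (hεR : ε ≤ R) (hμ0 : 0 ≤ μ) (hμ : μ < Real.pi)
    (h : ∀ ζ ∈ sectorBoundary ε R μ, f ζ = g ζ) :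
    sectorIntegral ε R μ f = sectorIntegral ε R μ g := by
  have arc : ∀ ρ, ρ = ε ∨ ρ = R →
      ∫ φ in (-μ)..μ, f (polarPoint ρ φ) * (I * polarPoint ρ φ) =
      ∫ φ in (-μ)..μ, g (polarPoint ρ φ) * (I * polarPoint ρ φ) := fun ρ hρ =>
    intervalIntegral.integral_congr fun φ hφ => by
      simp only [forall_arc_of_forall_sectorBoundary hε hεR hμ0 hμ h hρ φ hφ]
  have ray : ∀ φ : ℝ, |φ| = μ →
      ∫ r in ε..R, f (polarPoint r φ) * exp ((φ : ℂ) * I) =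
      ∫ r in ε..R, g (polarPoint r φ) * exp ((φ : ℂ) * I) := fun φ hφ =>
    intervalIntegral.integral_congr fun r hr => by
      simp only [forall_ray_of_forall_sectorBoundary hε hεR hμ h hφ r hr]
  simp only [sectorIntegral]
  rw [arc ε (Or.inl rfl), arc R (Or.inr rfl), ray μ (abs_of_nonneg hμ0),
    ray (-μ) (by rw [abs_neg, abs_of_nonneg hμ0])]

theorem sectorIntegral_eq_zero_of_hasDerivAt (hε : 0 < ε) (hεR : ε ≤ R) (hμ0 : 0 ≤ μ)
    (hμ : μ < Real.pi) {F : ℂ → ℂ} (hF : ∀ ζ ∈ sectorBoundary ε R μ, HasDerivAt F (f ζ) ζ)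
    (hf : ∀ ζ ∈ sectorBoundary ε R μ, ContinuousAt f ζ) :
    sectorIntegral ε R μ f = 0 := by
  have arc : ∀ ρ, ρ = ε ∨ ρ = R →
      ∫ φ in (-μ)..μ, f (polarPoint ρ φ) * (I * polarPoint ρ φ) =
        F (polarPoint ρ μ) - F (polarPoint ρ (-μ)) := fun ρ hρ =>
    integral_arc_of_hasDerivAt (forall_arc_of_forall_sectorBoundary hε hεR hμ0 hμ hF hρ)
      (forall_arc_of_forall_sectorBoundary hε hεR hμ0 hμ hf hρ)
  have ray : ∀ φ : ℝ, |φ| = μ →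
      ∫ r in ε..R, f (polarPoint r φ) * exp ((φ : ℂ) * I) =
        F (polarPoint R φ) - F (polarPoint ε φ) := fun φ hφ =>
    integral_ray_of_hasDerivAt (forall_ray_of_forall_sectorBoundary hε hεR hμ hF hφ)
      (forall_ray_of_forall_sectorBoundary hε hεR hμ hf hφ)
  simp only [sectorIntegral]
  rw [arc ε (Or.inl rfl), arc R (Or.inr rfl), ray μ (abs_of_nonneg hμ0),
    ray (-μ) (by rw [abs_neg, abs_of_nonneg hμ0])]
  ring

/-- Cauchy's theorem for an annular sector. -/
theorem sectorIntegral_eq_zero_of_differentiableOn (hε : 0 < ε) (hεR : ε ≤ R) (hμ0 : 0 ≤ μ)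
    (hμ : μ < Real.pi) (hf : DifferentiableOn ℂ f slitPlane) :
    sectorIntegral ε R μ f = 0 := by
  have hR : 0 < R := hε.trans_le hεR
  have hlog : Real.log ε ≤ Real.log R := Real.log_le_log hε hεR
  have hexp : ∀ x φ : ℝ, exp ((x : ℂ) + φ * I) = polarPoint (Real.exp x) φ := fun x φ => by
    rw [polarPoint, exp_add, ofReal_exp]
  -- The sector is the image under `exp` of the rectangle `[log ε, log R] × [-μ, μ]`, where Cauchy's
  -- theorem is known.
  have key := integral_boundary_rect_eq_zero_of_differentiableOn (fun w => f (exp w) * exp w)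
    ⟨Real.log ε, -μ⟩ ⟨Real.log R, μ⟩ (by
      refine DifferentiableOn.mul ?_ differentiable_exp.differentiableOn
      refine hf.comp differentiable_exp.differentiableOn ?_
      rintro ⟨x, y⟩ ⟨-, hy⟩
      simp only [mem_preimage] at hy
      rw [uIcc_of_le (by linarith)] at hy
      rw [mk_eq_add_mul_I, hexp]
      exact polarPoint_mem_slitPlane (Real.exp_pos _) ((abs_le.2 hy).trans_lt hμ))
  have ray : ∀ φ : ℝ, |φ| < Real.pi →
      ∫ x in (Real.log ε)..(Real.log R), f (exp ((x : ℂ) + φ * I)) * exp ((x : ℂ) + φ * I) =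
      ∫ r in ε..R, f (polarPoint r φ) * exp ((φ : ℂ) * I) := by
    intro φ hφ
    have := intervalIntegral.integral_deriv_smul_comp' (a := Real.log ε) (b := Real.log R)
      (f := Real.exp) (f' := Real.exp) (g := fun r => f (polarPoint r φ) * exp ((φ : ℂ) * I))
      (fun x _ => Real.hasDerivAt_exp x) Real.continuous_exp.continuousOn ?_
    · rw [Real.exp_log hε, Real.exp_log hR] at this
      rw [← this]
      refine intervalIntegral.integral_congr fun x _ => ?_
      simp only [hexp, Function.comp_apply, real_smul, polarPoint]
      ring
    · rintro _ ⟨x, -, rfl⟩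
      have h : ContinuousAt f (polarPoint (Real.exp x) φ) := (hf.differentiableAt
        (isOpen_slitPlane.mem_nhds (polarPoint_mem_slitPlane (Real.exp_pos x) hφ))).continuousAt
      exact (ContinuousAt.mul (ContinuousAt.comp (f := fun r => polarPoint r φ) h
        (hasDerivAt_polarPoint_radius _ φ).continuousAt) continuousAt_const).continuousWithinAt
  have r1 := ray μ (by rwa [abs_of_nonneg hμ0])
  have r2 := ray (-μ) (by rwa [abs_neg, abs_of_nonneg hμ0])
  simp only [hexp] at key r1 r2
  rw [r1, r2, Real.exp_log hε, Real.exp_log hR] at key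
  simp only [smul_eq_mul, ← intervalIntegral.integral_const_mul] at key
  have e : ∀ ρ φ : ℝ, f (polarPoint ρ φ) * (I * polarPoint ρ φ) =
      I * (f (polarPoint ρ φ) * polarPoint ρ φ) := fun ρ φ => by ring
  simp only [sectorIntegral, e]
  rw [← key]
  ring

end SectorBoundary

end

section

/-! ### The Cauchy integral formula for an annular sector -/

/-- If `1 - z/ζ` were on the cut, `z` would be `t ζ` with `t ≥ 1`, hence of the same argument and no
smaller modulus. -/
theorem one_sub_div_mem_slitPlane {z ζ : ℂ} (hζ : ζ ≠ 0) (h : ‖z‖ < ‖ζ‖ ∨ z.arg ≠ ζ.arg) :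
    1 - z / ζ ∈ slitPlane := by
  by_contra hs
  rw [mem_slitPlane_iff] at hs
  push Not at hs
  obtain ⟨h1, h2⟩ := hs
  simp only [sub_re, one_re, sub_im, one_im] at h1 h2
  have hw : z / ζ = (((z / ζ).re : ℝ) : ℂ) := by
    apply Complex.ext
    · simp
    · rw [ofReal_im]; linarith
  have ht : 1 ≤ (z / ζ).re := by linarith
  set t := (z / ζ).re with ht_def
  have hz : z = t * ζ := by rw [← hw, div_mul_cancel₀ _ hζ]
  rcases h with h | h
  · rw [hz, norm_mul, norm_real, Real.norm_eq_abs, abs_of_pos (by linarith)] at h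
    nlinarith [norm_nonneg ζ]
  · exact h (by rw [hz, arg_real_mul _ (by linarith)])

/-- The imaginary parts of `v` and `1 + 1/v` have opposite signs, so the sum of the arguments stays
in `(-π, π]`. With `v = -z/ζ` this compares the two primitives of `1/(ζ - z)` used below. -/
theorem log_one_add_eq_log_add_log {v : ℂ} (hv : v ∈ slitPlane) :
    log (1 + v) = log v + log (1 + 1 / v) := by
  have hv0 : v ≠ 0 := slitPlane_ne_zero hv
  have him : (1 + 1 / v).im = -v.im / normSq v := by simp
  have hsq : 0 < normSq v := normSq_pos.2 hv0
  have hpi := Real.pi_pos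
  have hprod : 1 + v = v * (1 + 1 / v) := by field_simp; ring
  have h1 : 1 + 1 / v ≠ 0 := by
    intro h0
    have : v = -1 := by
      rw [h0, mul_zero] at hprod
      linear_combination hprod
    rw [this] at hv
    norm_num [mem_slitPlane_iff] at hv
  rw [hprod, log_mul_eq_add_log_iff hv0 h1]
  rcases lt_trichotomy v.im 0 with h | h | h
  · have a1 := arg_neg_iff.2 h
    have a2 : 0 ≤ (1 + 1 / v).arg := by
      rw [arg_nonneg_iff, him]; exact div_nonneg (by linarith) hsq.le
    exact ⟨by linarith [neg_pi_lt_arg v], by linarith [arg_le_pi (1 + 1 / v)]⟩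
  · have hre : 0 < v.re := by
      rcases mem_slitPlane_iff.1 hv with h' | h'
      · exact h'
      · exact absurd h h'
    have a1 : v.arg = 0 := arg_eq_zero_iff.2 ⟨hre.le, h⟩
    rw [a1, zero_add]
    exact ⟨neg_pi_lt_arg _, arg_le_pi _⟩
  · have a1 : 0 ≤ v.arg := arg_nonneg_iff.2 h.le
    have a2 : (1 + 1 / v).arg < 0 := by
      rw [arg_neg_iff, him]; exact div_neg_of_neg_of_pos (by linarith) hsq
    exact ⟨by linarith [neg_pi_lt_arg (1 + 1 / v)], by linarith [arg_le_pi v]⟩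

theorem polarPoint_div_polarPoint {r s : ℝ} (φ ψ : ℝ) :
    polarPoint r φ / polarPoint s ψ = polarPoint (r / s) (φ - ψ) := by
  simp only [polarPoint, ofReal_div, ofReal_sub, sub_mul, exp_sub]
  rw [mul_div_mul_comm]

theorem polarPoint_add_pi (r φ : ℝ) : polarPoint r (φ + Real.pi) = -polarPoint r φ := by
  simp [polarPoint, add_mul, exp_add]

theorem polarPoint_sub_pi (r φ : ℝ) : polarPoint r (φ - Real.pi) = -polarPoint r φ := by
  simp [polarPoint, sub_mul, exp_sub, div_neg]

variable {ε R μ : ℝ} {z : ℂ}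

theorem ne_of_mem_sectorBoundary (hz1 : ε < ‖z‖) (hz2 : ‖z‖ < R) (hz3 : |z.arg| < μ) {ζ : ℂ}
    (hζ : ζ ∈ sectorBoundary ε R μ) : ζ ≠ z := by
  rintro rfl
  rcases hζ with ⟨-, -, h⟩ | ⟨h | h, -⟩
  · exact hz3.ne h
  · exact hz1.ne' h
  · exact hz2.ne h

/-- No single logarithm serves the whole boundary: `log ζ + log (1 - z/ζ)` is a primitive on the
rays and the outer arc but jumps on the inner arc, where `log (1 - ζ/z)` takes over. The sum
telescopes to the difference of the two primitives at the inner corners. It has imaginary part `arg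
z + π` at the upper corner, `arg z - π` at the lower one, and the same real part at both. -/
theorem sectorIntegral_inv_sub (hε : 0 < ε) (hμ : μ < Real.pi) (hz1 : ε < ‖z‖) (hz2 : ‖z‖ < R)
    (hz3 : |z.arg| < μ) :
    sectorIntegral ε R μ (fun ζ => 1 / (ζ - z)) = 2 * Real.pi * I := by
  have hμ0 : 0 < μ := (abs_nonneg _).trans_lt hz3
  have hεR : ε ≤ R := (hz1.trans hz2).le
  have hR : 0 < R := hε.trans_le hεR
  have hz0 : 0 < ‖z‖ := hε.trans hz1
  have hz0' : z ≠ 0 := norm_pos_iff.1 hz0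
  obtain ⟨hz4, hz5⟩ := abs_lt.1 hz3
  have hcont : ∀ ζ, ζ ≠ z → ContinuousAt (fun ζ => 1 / (ζ - z)) ζ := fun ζ h =>
    continuousAt_const.div (by fun_prop) (sub_ne_zero.2 h)
  have hcontB : ∀ ζ ∈ sectorBoundary ε R μ, ContinuousAt (fun ζ => 1 / (ζ - z)) ζ := fun ζ h =>
    hcont ζ (ne_of_mem_sectorBoundary hz1 hz2 hz3 h)
  have hF : ∀ ζ ∈ slitPlane, (‖z‖ < ‖ζ‖ ∨ z.arg ≠ ζ.arg) →
      HasDerivAt (fun ζ => log ζ + log (1 - z / ζ)) (1 / (ζ - z)) ζ := by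
    intro ζ hζ h
    have hζ0 := slitPlane_ne_zero hζ
    have hm := one_sub_div_mem_slitPlane hζ0 h
    have hsub : ζ - z ≠ 0 := by
      have := mul_ne_zero hζ0 (slitPlane_ne_zero hm)
      rwa [mul_sub, mul_one, mul_div_cancel₀ _ hζ0] at this
    have h1 : HasDerivAt (fun ζ => 1 - z / ζ) (z / ζ ^ 2) ζ := by
      have := ((hasDerivAt_inv hζ0).const_mul z).const_sub 1
      simp only [← div_eq_mul_inv] at this
      refine this.congr_deriv ?_
      field_simp
    refine ((hasDerivAt_log hζ).add (h1.clog hm)).congr_deriv ?_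
    have h2 : 1 - z / ζ = (ζ - z) / ζ := by field_simp
    rw [h2]
    field_simp
    ring
  have hM : ∀ ζ : ℂ, ‖ζ‖ < ‖z‖ → HasDerivAt (fun ζ => log (1 - ζ / z)) (1 / (ζ - z)) ζ := by
    intro ζ h
    have hsub : ζ - z ≠ 0 := sub_ne_zero.2 (by rintro rfl; exact lt_irrefl _ h)
    have h1 : HasDerivAt (fun ζ => 1 - ζ / z) (-(1 / z)) ζ :=
      ((hasDerivAt_id ζ).div_const z).const_sub 1
    refine (h1.clog (one_sub_div_mem_slitPlane hz0' (Or.inl h))).congr_deriv ?_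
    have h2 : 1 - ζ / z = -(ζ - z) / z := by field_simp; ring
    rw [h2]
    field_simp
  have outer := integral_arc_of_hasDerivAt (f := fun ζ => 1 / (ζ - z)) (ρ := R) (a := -μ) (b := μ)
    (F := fun ζ => log ζ + log (1 - z / ζ))
    (fun φ hφ => by
      rw [uIcc_of_le (by linarith)] at hφ
      refine hF _ (polarPoint_mem_slitPlane hR ((abs_le.2 hφ).trans_lt hμ)) (Or.inl ?_)
      rwa [norm_polarPoint hR.le])
    (forall_arc_of_forall_sectorBoundary hε hεR hμ0.le hμ hcontB (Or.inr rfl))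
  have inner := integral_arc_of_hasDerivAt (f := fun ζ => 1 / (ζ - z)) (ρ := ε) (a := -μ) (b := μ)
    (F := fun ζ => log (1 - ζ / z))
    (fun φ hφ => hM _ (by rwa [norm_polarPoint hε.le]))
    (forall_arc_of_forall_sectorBoundary hε hεR hμ0.le hμ hcontB (Or.inl rfl))
  have ray : ∀ φ : ℝ, |φ| = μ →
      ∫ r in ε..R, 1 / (polarPoint r φ - z) * exp ((φ : ℂ) * I) =
        (log (polarPoint R φ) + log (1 - z / polarPoint R φ)) -
        (log (polarPoint ε φ) + log (1 - z / polarPoint ε φ)) := fun φ hφ =>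
    integral_ray_of_hasDerivAt (f := fun ζ => 1 / (ζ - z))
      (F := fun ζ => log ζ + log (1 - z / ζ))
      (fun r hr => by
        rw [uIcc_of_le hεR] at hr
        have hr0 : 0 < r := hε.trans_le hr.1
        refine hF _ (polarPoint_mem_slitPlane hr0 (by rwa [hφ])) (Or.inr ?_)
        have := abs_le.1 hφ.le
        rw [arg_polarPoint hr0 ⟨by linarith, by linarith⟩]
        rintro h
        rw [h] at hz3
        exact hz3.ne hφ)
      (forall_ray_of_forall_sectorBoundary hε hεR hμ hcontB hφ)
  have link : ∀ φ ψ : ℝ, |ψ| < Real.pi → -(z / polarPoint ε φ) = polarPoint (‖z‖ / ε) ψ →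
      log (1 - z / polarPoint ε φ) - log (1 - polarPoint ε φ / z) =
        Real.log (‖z‖ / ε) + ψ * I := by
    intro φ ψ hψ h
    have hpos : 0 < ‖z‖ / ε := div_pos hz0 hε
    have := log_one_add_eq_log_add_log (polarPoint_mem_slitPlane hpos hψ)
    rw [log_polarPoint hpos ⟨(abs_lt.1 hψ).1, (abs_lt.1 hψ).2.le⟩, ← h] at this
    rw [sub_eq_add_neg 1 (z / _), this]
    have e : 1 / -(z / polarPoint ε φ) = -(polarPoint ε φ / z) := by
      rw [one_div, inv_neg, inv_div]
    rw [e, ← sub_eq_add_neg]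
    ring
  have hzp := polarPoint_norm_arg z
  -- The shifts by `π` and `-π` bring the argument of `-z/ζ` into the principal range at the two
  -- corners.
  have l1 := link μ (z.arg - μ + Real.pi) (abs_lt.2 ⟨by linarith, by linarith⟩) (by
    rw [polarPoint_add_pi, ← polarPoint_div_polarPoint, hzp])
  have l2 := link (-μ) (z.arg - -μ - Real.pi) (abs_lt.2 ⟨by linarith, by linarith⟩) (by
    rw [polarPoint_sub_pi, ← polarPoint_div_polarPoint, hzp])
  have r1 := ray μ (abs_of_pos hμ0)
  have r2 := ray (-μ) (by rw [abs_neg, abs_of_pos hμ0])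
  have m1 : μ ∈ Ioc (-Real.pi) Real.pi := ⟨by linarith, hμ.le⟩
  have m2 : -μ ∈ Ioc (-Real.pi) Real.pi := ⟨by linarith, by linarith⟩
  simp only [sectorIntegral]
  rw [outer, inner, r1, r2]
  simp only [log_polarPoint hε m1, log_polarPoint hε m2]
  push_cast at l1 l2 ⊢
  linear_combination l1 - l2

/-- The divided difference `(h ζ - h z)/(ζ - z)` extends holomorphically across `z`, so its integral
vanishes and only `h z` times the integral of `1/(ζ - z)` survives. -/
theorem sectorIntegral_div_sub (hε : 0 < ε) (hμ : μ < Real.pi) (hz1 : ε < ‖z‖) (hz2 : ‖z‖ < R)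
    (hz3 : |z.arg| < μ) {h : ℂ → ℂ} (hh : DifferentiableOn ℂ h slitPlane) :
    sectorIntegral ε R μ (fun ζ => h ζ / (ζ - z)) = 2 * Real.pi * I * h z := by
  have hμ0 : 0 < μ := (abs_nonneg _).trans_lt hz3
  have hεR : ε ≤ R := (hz1.trans hz2).le
  have hzs : z ∈ slitPlane := by
    rw [mem_slitPlane_iff_arg, ← norm_pos_iff]
    exact ⟨((le_abs_self _).trans_lt (hz3.trans hμ)).ne, hε.trans hz1⟩
  have hne := fun ζ (hζ : ζ ∈ sectorBoundary ε R μ) =>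
    sub_ne_zero.2 (ne_of_mem_sectorBoundary hz1 hz2 hz3 hζ)
  have hd := sectorIntegral_eq_zero_of_differentiableOn hε hεR hμ0.le hμ
    ((differentiableOn_dslope (isOpen_slitPlane.mem_nhds hzs)).2 hh)
  rw [sectorIntegral_congr (g := fun ζ => h ζ / (ζ - z) - h z * (1 / (ζ - z))) hε hεR hμ0.le hμ
    (fun ζ hζ => by
      rw [dslope_of_ne _ (sub_ne_zero.1 (hne ζ hζ)), slope_def_field]; ring),
    sectorIntegral_sub hε hεR hμ0.le hμ, sectorIntegral_const_mul,
    sectorIntegral_inv_sub hε hμ hz1 hz2 hz3] at hd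
  · linear_combination hd
  · intro ζ hζ
    have hs := sectorBoundary_subset_slitPlane hε hεR hμ hζ
    exact (hh.differentiableAt (isOpen_slitPlane.mem_nhds hs)).continuousAt.div (by fun_prop)
      (hne ζ hζ)
  · intro ζ hζ
    exact continuousAt_const.mul (continuousAt_const.div (by fun_prop) (hne ζ hζ))

/-- Cauchy's formula for the derivatives, on an annular sector. -/
theorem sectorIntegral_div_sub_pow (hε : 0 < ε) (hμ : μ < Real.pi) (hz1 : ε < ‖z‖)
    (hz2 : ‖z‖ < R) (hz3 : |z.arg| < μ) (n : ℕ) {h : ℂ → ℂ}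
    (hh : DifferentiableOn ℂ h slitPlane) :
    sectorIntegral ε R μ (fun ζ => h ζ / (ζ - z) ^ (n + 1)) =
      2 * Real.pi * I / n.factorial * iteratedDeriv n h z := by
  have hμ0 : 0 < μ := (abs_nonneg _).trans_lt hz3
  have hεR : ε ≤ R := (hz1.trans hz2).le
  have hne := fun ζ (hζ : ζ ∈ sectorBoundary ε R μ) =>
    sub_ne_zero.2 (ne_of_mem_sectorBoundary hz1 hz2 hz3 hζ)
  induction n generalizing h with
  | zero => simpa using sectorIntegral_div_sub hε hμ hz1 hz2 hz3 hh
  | succ n ih =>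
    have hh' : DifferentiableOn ℂ (deriv h) slitPlane := hh.deriv isOpen_slitPlane
    have hda : ∀ k : ℂ → ℂ, DifferentiableOn ℂ k slitPlane → ∀ ζ ∈ sectorBoundary ε R μ,
        DifferentiableAt ℂ k ζ := fun k hk ζ hζ =>
      hk.differentiableAt (isOpen_slitPlane.mem_nhds (sectorBoundary_subset_slitPlane hε hεR hμ hζ))
    have c1 : ∀ k : ℂ → ℂ, DifferentiableOn ℂ k slitPlane → ∀ m : ℕ, ∀ ζ ∈ sectorBoundary ε R μ,
        ContinuousAt (fun ζ => k ζ / (ζ - z) ^ m) ζ := fun k hk m ζ hζ =>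
      (hda k hk ζ hζ).continuousAt.div (by fun_prop) (pow_ne_zero _ (hne ζ hζ))
    have c2 : ∀ ζ ∈ sectorBoundary ε R μ,
        ContinuousAt (fun ζ => ((n : ℂ) + 1) * (h ζ / (ζ - z) ^ (n + 1 + 1))) ζ := fun ζ hζ =>
      continuousAt_const.mul (c1 h hh _ ζ hζ)
    -- Integration by parts: the integral of the derivative of `h/(ζ - z)^(n+1)` is zero, which
    -- trades one order of the pole for one derivative of `h`.
    have hz := sectorIntegral_eq_zero_of_hasDerivAt hε hεR hμ0.le hμ
      (F := fun ζ => h ζ / (ζ - z) ^ (n + 1))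
      (f := fun ζ => deriv h ζ / (ζ - z) ^ (n + 1) - ((n : ℂ) + 1) * (h ζ / (ζ - z) ^ (n + 1 + 1)))
      (fun ζ hζ => by
        have h1 : HasDerivAt (fun ζ : ℂ => (ζ - z) ^ (n + 1)) (((n : ℂ) + 1) * (ζ - z) ^ n) ζ := by
          simpa using ((hasDerivAt_id ζ).sub_const z).fun_pow (n + 1)
        refine ((hda h hh ζ hζ).hasDerivAt.div h1 (pow_ne_zero _ (hne ζ hζ))).congr_deriv ?_
        have := hne ζ hζ
        field_simp
        ring)
      (fun ζ hζ => (c1 _ hh' _ ζ hζ).sub (c2 ζ hζ))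
    rw [sectorIntegral_sub hε hεR hμ0.le hμ (c1 _ hh' _) c2, sectorIntegral_const_mul, ih hh',
      ← iteratedDeriv_succ'] at hz
    have hn : ((n : ℂ) + 1) ≠ 0 := Nat.cast_add_one_ne_zero n
    have hf : (n.factorial : ℂ) ≠ 0 := by exact_mod_cast n.factorial_ne_zero
    rw [Nat.factorial_succ]
    push_cast
    field_simp at hz ⊢
    linear_combination -hz

end

section

/-! ### The contour as a curve parametrised by the real line -/

/-- The distance to the origin of the point of parameter `s` on the contour. -/
def contourRadius (ε μ s : ℝ) : ℝ := ε + max (|s| - μ) 0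

/-- The argument of the point of parameter `s` on the contour. -/
def contourAngle (μ s : ℝ) : ℝ := max (-μ) (min s μ)

/-- A parametrisation of the contour `γ(ε, μ)` by the real line. -/
def contourParam (ε μ s : ℝ) : ℂ := polarPoint (contourRadius ε μ s) (contourAngle μ s)

/-- The derivative of the parametrisation of the contour. -/
def contourVelocity (ε μ s : ℝ) : ℂ :=
  if s ≤ -μ then -exp (((-μ : ℝ) : ℂ) * I)
  else if s ≤ μ then I * polarPoint ε s else exp ((μ : ℂ) * I)

variable {ε μ : ℝ}

theorem le_contourRadius (s : ℝ) : ε ≤ contourRadius ε μ s := by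
  simp [contourRadius]

theorem abs_contourAngle_le (hμ0 : 0 ≤ μ) (s : ℝ) : |contourAngle μ s| ≤ μ := by
  rw [abs_le, contourAngle]
  exact ⟨le_max_left _ _, max_le (by linarith) (min_le_right _ _)⟩

theorem contourAngle_mem_Ioc (hμ0 : 0 ≤ μ) (hμ : μ < Real.pi) (s : ℝ) :
    contourAngle μ s ∈ Ioc (-Real.pi) Real.pi := by
  have := abs_le.1 (abs_contourAngle_le hμ0 s)
  exact ⟨by linarith, by linarith⟩

theorem norm_contourParam (hε : 0 < ε) (s : ℝ) : ‖contourParam ε μ s‖ = contourRadius ε μ s :=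
  norm_polarPoint (hε.le.trans (le_contourRadius s)) _

theorem arg_contourParam (hε : 0 < ε) (hμ0 : 0 ≤ μ) (hμ : μ < Real.pi) (s : ℝ) :
    (contourParam ε μ s).arg = contourAngle μ s :=
  arg_polarPoint (hε.trans_le (le_contourRadius s)) (contourAngle_mem_Ioc hμ0 hμ s)

theorem continuous_contourParam : Continuous (contourParam ε μ) := by
  have h1 : Continuous (contourRadius ε μ) := by unfold contourRadius; fun_prop
  have h2 : Continuous (contourAngle μ) := by unfold contourAngle; fun_prop
  exact continuous_polarPoint.comp (h1.prodMk h2)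

theorem contourParam_of_le (hμ0 : 0 < μ) {s : ℝ} (hs : s ≤ -μ) :
    contourParam ε μ s = polarPoint (ε - μ - s) (-μ) := by
  rw [contourParam, contourRadius, contourAngle, abs_of_nonpos (by linarith),
    max_eq_left (by linarith), min_eq_left (by linarith), max_eq_left hs]
  ring_nf

theorem contourParam_of_mem_Icc {s : ℝ} (hs : s ∈ Icc (-μ) μ) :
    contourParam ε μ s = polarPoint ε s := by
  rw [contourParam, contourRadius, contourAngle,
    max_eq_right (sub_nonpos.2 (abs_le.2 hs)), min_eq_left hs.2, max_eq_right hs.1, add_zero]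

theorem contourParam_of_ge (hμ0 : 0 < μ) {s : ℝ} (hs : μ ≤ s) :
    contourParam ε μ s = polarPoint (s + (ε - μ)) μ := by
  rw [contourParam, contourRadius, contourAngle, abs_of_nonneg (by linarith),
    max_eq_left (by linarith), min_eq_right hs, max_eq_right (by linarith)]
  ring_nf

theorem contourParam_mem_contourSet (hε : 0 < ε) (hμ0 : 0 < μ) (hμ : μ < Real.pi) (s : ℝ) :
    contourParam ε μ s ∈ contourSet ε μ := by
  have hn := norm_contourParam (μ := μ) hε s
  have ha := arg_contourParam hε hμ0.le hμ s
  rcases le_or_gt |s| μ with h | h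
  · left
    refine ⟨?_, ?_⟩
    · rw [hn, contourRadius, max_eq_right (by linarith), add_zero]
    · rw [ha]; exact abs_contourAngle_le hμ0.le s
  · right
    refine ⟨hn ▸ le_contourRadius s, ?_⟩
    rw [ha, contourAngle]
    rcases lt_abs.1 h with h | h
    · rw [min_eq_right h.le, max_eq_right (by linarith), abs_of_pos hμ0]
    · rw [min_eq_left (by linarith), max_eq_left (by linarith), abs_neg, abs_of_pos hμ0]

theorem contourParam_mem_slitPlane (hε : 0 < ε) (hμ0 : 0 < μ) (hμ : μ < Real.pi) (s : ℝ) :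
    contourParam ε μ s ∈ slitPlane :=
  polarPoint_mem_slitPlane (hε.trans_le (le_contourRadius s))
    ((abs_contourAngle_le hμ0.le s).trans_lt hμ)

theorem measurable_contourVelocity : Measurable (contourVelocity ε μ) := by
  unfold contourVelocity
  have h : Measurable fun s : ℝ => I * polarPoint ε s := by
    have : Continuous fun s : ℝ => I * polarPoint ε s := by unfold polarPoint; fun_prop
    exact this.measurable
  exact Measurable.ite measurableSet_Iic measurable_const
    (Measurable.ite measurableSet_Iic h measurable_const)

theorem norm_contourVelocity_le (hε : 0 < ε) (s : ℝ) : ‖contourVelocity ε μ s‖ ≤ 1 + ε := by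
  unfold contourVelocity
  split_ifs
  · rw [norm_neg, norm_exp_ofReal_mul_I]; linarith
  · rw [norm_mul, norm_I, norm_polarPoint hε.le]; linarith
  · rw [norm_exp_ofReal_mul_I]; linarith

section Pullback

variable {f : ℂ → ℂ}

theorem integrable_mul_contourVelocity (hε : 0 < ε)
    (hf : Integrable fun s => f (contourParam ε μ s)) :
    Integrable fun s => f (contourParam ε μ s) * contourVelocity ε μ s :=
  hf.mul_bdd measurable_contourVelocity.aestronglyMeasurable
    (Eventually.of_forall (norm_contourVelocity_le hε))

theorem contourIntegrable_of_integrable (hμ0 : 0 < μ)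
    (hf : Integrable fun s => f (contourParam ε μ s)) : ContourIntegrable ε μ f := by
  refine ⟨?_, ?_, ?_⟩
  · have h1 : IntegrableOn (fun s => f (polarPoint (ε - μ - s) (-μ))) (Iio (-μ)) :=
      (hf.integrableOn (s := Iio (-μ))).congr_fun
        (fun s hs => by simp only [contourParam_of_le hμ0 (le_of_lt hs)]) measurableSet_Iio
    have := ((Measure.measurePreserving_sub_left volume (ε - μ)).integrableOn_comp_preimage
      (MeasurableEquiv.subLeft (ε - μ)).measurableEmbedding
      (f := fun r => f (polarPoint r (-μ))) (s := Ioi ε)).1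
    refine this ?_
    rw [show (fun x => ε - μ - x) ⁻¹' Ioi ε = Iio (-μ) by
      ext x; simp only [mem_preimage, mem_Ioi, mem_Iio]; constructor <;> intro <;> linarith]
    exact h1
  · rw [intervalIntegrable_iff_integrableOn_Ioc_of_le (by linarith)]
    exact (hf.integrableOn (s := Ioc (-μ) μ)).congr_fun
      (fun s hs => by simp only [contourParam_of_mem_Icc (Ioc_subset_Icc_self hs)])
      measurableSet_Ioc
  · have h1 : IntegrableOn (fun s => f (polarPoint (s + (ε - μ)) μ)) (Ioi μ) :=
      (hf.integrableOn (s := Ioi μ)).congr_fun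
        (fun s hs => by simp only [contourParam_of_ge hμ0 (le_of_lt hs)]) measurableSet_Ioi
    have := ((measurePreserving_add_right volume (ε - μ)).integrableOn_comp_preimage
      (MeasurableEquiv.addRight (ε - μ)).measurableEmbedding
      (f := fun r => f (polarPoint r μ)) (s := Ioi ε)).1
    refine this ?_
    rw [show (fun x => x + (ε - μ)) ⁻¹' Ioi ε = Ioi μ by
      ext x; simp only [mem_preimage, mem_Ioi]; constructor <;> intro <;> linarith]
    exact h1

/-- A single integral over `ℝ` lets dominated convergence and holomorphy in a parameter be applied
once instead of piece by piece. The rays are run at unit speed, so the substitutions are a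
reflection and a translation. -/
theorem contourIntegral_eq_integral (hε : 0 < ε) (hμ0 : 0 < μ)
    (hf : Integrable fun s => f (contourParam ε μ s)) :
    contourIntegral ε μ f = ∫ s, f (contourParam ε μ s) * contourVelocity ε μ s := by
  have hg := integrable_mul_contourVelocity hε hf
  set g := fun s => f (contourParam ε μ s) * contourVelocity ε μ s with hgdef
  have h1 : ∫ s in Iic (-μ), g s =
      -∫ r in Ioi ε, f (polarPoint r (-μ)) * exp (((-μ : ℝ) : ℂ) * I) := by
    rw [integral_Iic_eq_integral_Iio, ← integral_neg,
      ← (Measure.measurePreserving_sub_left volume (ε - μ)).setIntegral_preimage_emb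
      (MeasurableEquiv.subLeft (ε - μ)).measurableEmbedding
      (fun r => -(f (polarPoint r (-μ)) * exp (((-μ : ℝ) : ℂ) * I))) (Ioi ε),
      show (fun x => ε - μ - x) ⁻¹' Ioi ε = Iio (-μ) by
        ext x; simp only [mem_preimage, mem_Ioi, mem_Iio]; constructor <;> intro <;> linarith]
    refine setIntegral_congr_fun measurableSet_Iio fun s hs => ?_
    have hs' : s ≤ -μ := le_of_lt hs
    simp only [hgdef, contourParam_of_le hμ0 hs', contourVelocity, if_pos hs']
    ring
  have h2 : ∫ s in Ioc (-μ) μ, g s =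
      ∫ φ in (-μ)..μ, f (polarPoint ε φ) * (I * polarPoint ε φ) := by
    rw [intervalIntegral.integral_of_le (by linarith)]
    refine setIntegral_congr_fun measurableSet_Ioc fun s hs => ?_
    simp only [hgdef, contourParam_of_mem_Icc (Ioc_subset_Icc_self hs), contourVelocity,
      if_neg (not_le.2 hs.1), if_pos hs.2]
  have h3 : ∫ s in Ioi μ, g s = ∫ r in Ioi ε, f (polarPoint r μ) * exp ((μ : ℂ) * I) := by
    rw [← (measurePreserving_add_right volume (ε - μ)).setIntegral_preimage_emb
      (MeasurableEquiv.addRight (ε - μ)).measurableEmbedding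
      (fun r => f (polarPoint r μ) * exp ((μ : ℂ) * I)) (Ioi ε),
      show (fun x => x + (ε - μ)) ⁻¹' Ioi ε = Ioi μ by
        ext x; simp only [mem_preimage, mem_Ioi]; constructor <;> intro <;> linarith]
    refine setIntegral_congr_fun measurableSet_Ioi fun s hs => ?_
    have hs' : μ < s := hs
    simp only [hgdef, contourParam_of_ge hμ0 (le_of_lt hs), contourVelocity,
      if_neg (show ¬ s ≤ -μ by linarith), if_neg (not_le.2 hs')]
  rw [contourIntegral, ← h1, ← h2, ← h3, ← intervalIntegral.integral_Iic_add_Ioi hg.integrableOn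
    (b := μ) hg.integrableOn, ← Iic_union_Ioc_eq_Iic (show -μ ≤ μ by linarith),
    setIntegral_union (Iic_disjoint_Ioc le_rfl) measurableSet_Ioc hg.integrableOn hg.integrableOn]

end Pullback

/-! ### Change of radius -/

/-- The rays beyond radius `R` cancel; no holomorphy is involved. -/
theorem contourIntegral_sub_contourIntegral {R : ℝ} {f : ℂ → ℂ} (hεR : ε ≤ R)
    (hf : ContourIntegrable ε μ f) :
    contourIntegral R μ f - contourIntegral ε μ f = sectorIntegral ε R μ f := by
  have ray : ∀ φ : ℝ, IntegrableOn (fun r => f (polarPoint r φ)) (Ioi ε) →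
      ∫ r in Ioi ε, f (polarPoint r φ) * exp ((φ : ℂ) * I) =
      (∫ r in ε..R, f (polarPoint r φ) * exp ((φ : ℂ) * I)) +
      ∫ r in Ioi R, f (polarPoint r φ) * exp ((φ : ℂ) * I) := by
    intro φ h
    have h' : IntegrableOn (fun r => f (polarPoint r φ) * exp ((φ : ℂ) * I)) (Ioi ε) :=
      h.mul_const _
    rw [← Ioc_union_Ioi_eq_Ioi hεR, setIntegral_union Ioc_disjoint_Ioi_same measurableSet_Ioi
      (h'.mono_set Ioc_subset_Ioi_self) (h'.mono_set (Ioi_subset_Ioi hεR)),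
      intervalIntegral.integral_of_le hεR]
  simp only [contourIntegral, sectorIntegral]
  rw [ray _ hf.1, ray _ hf.2.2]
  ring

end

section

/-! ### Decay of the integrand along the contour -/

/-- The function `exp(ζ^{1/α}) ζ^c`, with principal powers. -/
def expRootMulCpow (α : ℝ) (c ζ : ℂ) : ℂ := exp (ζ ^ ((1 / α : ℝ) : ℂ)) * ζ ^ c

theorem differentiableOn_expRootMulCpow (α : ℝ) (c : ℂ) :
    DifferentiableOn ℂ (expRootMulCpow α c) slitPlane := fun ζ hζ =>
  ((((hasDerivAt_id ζ).cpow_const hζ).cexp.mul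
    ((hasDerivAt_id ζ).cpow_const hζ)).differentiableAt).differentiableWithinAt

theorem measurable_expRootMulCpow (α : ℝ) (c : ℂ) : Measurable (expRootMulCpow α c) := by
  unfold expRootMulCpow
  fun_prop

theorem exists_rpow_mul_exp_neg_le {ε κ a : ℝ} (hε : 0 < ε) (hκ : 0 < κ) (ha : 0 < a) (q : ℝ) :
    ∃ C, 0 ≤ C ∧ ∀ x, ε ≤ x → x ^ q * Real.exp (-κ * x ^ a) ≤ C := by
  -- From `exp y ≥ y^m / m!` with `m ≥ q/a`, the power `x^(q - a m)` that is left does not increase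
  -- on `[ε, ∞)`.
  obtain ⟨m, hm⟩ := exists_nat_ge (q / a)
  refine ⟨ε ^ (q - a * m) * (m.factorial / κ ^ m), by positivity, fun x hx => ?_⟩
  have hx0 : 0 < x := hε.trans_le hx
  have hxa : 0 < x ^ a := Real.rpow_pos_of_pos hx0 a
  have h1 : Real.exp (-κ * x ^ a) ≤ m.factorial / (κ * x ^ a) ^ m := by
    rw [neg_mul, Real.exp_neg, inv_le_comm₀ (Real.exp_pos _) (by positivity), inv_div]
    exact Real.pow_div_factorial_le_exp _ (by positivity) m
  have h2 : x ^ (q - a * m) ≤ ε ^ (q - a * m) := by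
    refine Real.rpow_le_rpow_of_nonpos hε hx ?_
    rw [div_le_iff₀ ha] at hm
    linarith
  have h3 : x ^ q * (m.factorial / (κ * x ^ a) ^ m) = x ^ (q - a * m) * (m.factorial / κ ^ m) := by
    rw [Real.rpow_sub hx0, Real.rpow_mul hx0.le, Real.rpow_natCast, mul_pow]
    field_simp
  calc x ^ q * Real.exp (-κ * x ^ a) ≤ x ^ q * (m.factorial / (κ * x ^ a) ^ m) := by gcongr
    _ = x ^ (q - a * m) * (m.factorial / κ ^ m) := h3
    _ ≤ _ := by gcongr

theorem norm_exp_polarPoint_cpow {α r φ : ℝ} (hr : 0 < r) (hφ : φ ∈ Ioc (-Real.pi) Real.pi) :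
    ‖exp (polarPoint r φ ^ ((1 / α : ℝ) : ℂ))‖ = Real.exp (r ^ (1 / α) * Real.cos (φ / α)) := by
  rw [norm_exp, polarPoint_cpow hr hφ, ← ofReal_cpow hr.le, re_ofReal_mul,
    show (φ : ℂ) * I * ((1 / α : ℝ) : ℂ) = ((φ / α : ℝ) : ℂ) * I by push_cast; ring,
    exp_ofReal_mul_I_re]

/-- This is the source of the decay of `exp(ζ^{1/α})` on the rays. -/
theorem cos_div_neg {α μ : ℝ} (hα : 0 < α) (h1 : Real.pi * α / 2 < μ) (h2 : μ < α * Real.pi) :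
    Real.cos (μ / α) < 0 := by
  have hpi := Real.pi_pos
  refine Real.cos_neg_of_pi_div_two_lt_of_lt ?_ ?_
  · rw [lt_div_iff₀ hα]; linarith
  · rw [div_lt_iff₀ hα]; nlinarith

variable {α ε μ : ℝ}

theorem exists_norm_exp_contourParam_le (hα : 0 < α) (hε : 0 < ε)
    (hμ1 : Real.pi * α / 2 < μ) (hμ2 : μ < α * Real.pi) (hμ : μ < Real.pi) (p : ℝ) :
    ∃ C, 0 ≤ C ∧ ∀ s, ‖exp (contourParam ε μ s ^ ((1 / α : ℝ) : ℂ))‖ * contourRadius ε μ s ^ p ≤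
      C * (1 + ‖s‖) ^ (-2 : ℝ) := by
  have hμ0 : 0 < μ := lt_trans (by have := Real.pi_pos; positivity) hμ1
  obtain ⟨κ, hκ⟩ : ∃ κ, κ = -Real.cos (μ / α) := ⟨_, rfl⟩
  have hκ0 : 0 < κ := by have := cos_div_neg hα hμ1 hμ2; linarith
  -- The two extra powers of the radius pay for `(1 + ‖s‖)^(-2)`, through `1 + ‖s‖ ≤ L ρ`.
  obtain ⟨C, hC0, hC⟩ := exists_rpow_mul_exp_neg_le hε hκ0 (one_div_pos.2 hα) (p + 2)
  set L := 1 + (1 + μ) / ε with hL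
  have hL0 : 0 < L := by positivity
  -- The factor `exp((1 + κ) ε^{1/α})` lets the bound for the rays hold on the arc too, where the
  -- cosine is only known to be at most `1`.
  refine ⟨Real.exp ((1 + κ) * ε ^ (1 / α)) * C * L ^ 2, by positivity, fun s => ?_⟩
  set ρ := contourRadius ε μ s with hρ
  have hερ : ε ≤ ρ := le_contourRadius s
  have hρ0 : 0 < ρ := hε.trans_le hερ
  have hexp : ‖exp (contourParam ε μ s ^ ((1 / α : ℝ) : ℂ))‖ ≤
      Real.exp ((1 + κ) * ε ^ (1 / α)) * Real.exp (-κ * ρ ^ (1 / α)) := by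
    rw [contourParam, norm_exp_polarPoint_cpow hρ0 (contourAngle_mem_Ioc hμ0.le hμ s),
      ← Real.exp_add, Real.exp_le_exp]
    have hε' : 0 < ε ^ (1 / α) := Real.rpow_pos_of_pos hε _
    rcases le_or_gt |s| μ with h | h
    · have : ρ = ε := by rw [hρ, contourRadius, max_eq_right (by linarith), add_zero]
      rw [this]
      nlinarith [Real.cos_le_one (contourAngle μ s / α)]
    · have : Real.cos (contourAngle μ s / α) = -κ := by
        rw [hκ, neg_neg, contourAngle]
        rcases lt_abs.1 h with h | h
        · rw [min_eq_right h.le, max_eq_right (by linarith)]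
        · rw [min_eq_left (by linarith), max_eq_left (by linarith), neg_div, Real.cos_neg]
      rw [this]
      nlinarith
  have hsL : 1 + ‖s‖ ≤ L * ρ := by
    have h1 : |s| - μ ≤ ρ - ε := by rw [hρ, contourRadius]; linarith [le_max_left (|s| - μ) 0]
    have h2 : (1 + μ) ≤ (1 + μ) / ε * ρ := by
      rw [div_mul_eq_mul_div, le_div_iff₀ hε]; gcongr
    rw [Real.norm_eq_abs, hL, add_mul, one_mul]
    linarith
  have hs2 : ρ ^ p ≤ ρ ^ (p + 2) * L ^ 2 * (1 + ‖s‖) ^ (-2 : ℝ) := by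
    have h1 : (L * ρ) ^ (-2 : ℝ) ≤ (1 + ‖s‖) ^ (-2 : ℝ) :=
      Real.rpow_le_rpow_of_nonpos (by positivity) hsL (by norm_num)
    have h2 : ρ ^ p = ρ ^ (p + 2) * L ^ 2 * (L * ρ) ^ (-2 : ℝ) := by
      rw [Real.rpow_neg (by positivity), Real.rpow_add hρ0, Real.rpow_two, Real.rpow_two, mul_pow]
      field_simp
    rw [h2]
    gcongr
  calc _ ≤ (Real.exp ((1 + κ) * ε ^ (1 / α)) * Real.exp (-κ * ρ ^ (1 / α))) *
        (ρ ^ (p + 2) * L ^ 2 * (1 + ‖s‖) ^ (-2 : ℝ)) := by gcongr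
    _ = Real.exp ((1 + κ) * ε ^ (1 / α)) * (ρ ^ (p + 2) * Real.exp (-κ * ρ ^ (1 / α))) *
        L ^ 2 * (1 + ‖s‖) ^ (-2 : ℝ) := by ring
    _ ≤ _ := by gcongr; exact hC ρ hερ

theorem norm_cpow_le_rpow_mul_exp (z c : ℂ) :
    ‖z ^ c‖ ≤ ‖z‖ ^ c.re * Real.exp (Real.pi * ‖c‖) := by
  refine (norm_cpow_le z c).trans ?_
  rw [div_eq_mul_inv, ← Real.exp_neg]
  gcongr
  calc -(z.arg * c.im) ≤ |z.arg * c.im| := neg_le_abs _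
    _ = |z.arg| * |c.im| := abs_mul _ _
    _ ≤ Real.pi * ‖c‖ := by gcongr; exacts [abs_arg_le_pi z, abs_im_le_norm c]

/-- Uniformity over bounded `c` is what makes Hankel's integral holomorphic in `s`. It comes from
bounding `ρ^(re c)` by `ρ^M + ρ^(-M)`, whichever side of `1` the radius `ρ` lies on. -/
theorem exists_norm_expRootMulCpow_le (hα : 0 < α) (hε : 0 < ε)
    (hμ1 : Real.pi * α / 2 < μ) (hμ2 : μ < α * Real.pi) (hμ : μ < Real.pi) (M : ℝ) :
    ∃ C, 0 ≤ C ∧ ∀ c : ℂ, ‖c‖ ≤ M → ∀ s, ‖expRootMulCpow α c (contourParam ε μ s)‖ ≤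
      C * (1 + ‖s‖) ^ (-2 : ℝ) := by
  obtain ⟨C₁, h1, hC₁⟩ := exists_norm_exp_contourParam_le hα hε hμ1 hμ2 hμ M
  obtain ⟨C₂, h2, hC₂⟩ := exists_norm_exp_contourParam_le hα hε hμ1 hμ2 hμ (-M)
  refine ⟨(C₁ + C₂) * Real.exp (Real.pi * M), by positivity, fun c hc s => ?_⟩
  have hρ0 : 0 < contourRadius ε μ s := hε.trans_le (le_contourRadius s)
  have hre := abs_le.1 ((abs_re_le_norm c).trans hc)
  have h3 : contourRadius ε μ s ^ c.re ≤ contourRadius ε μ s ^ M + contourRadius ε μ s ^ (-M) := by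
    have p1 := Real.rpow_pos_of_pos hρ0 M
    have p2 := Real.rpow_pos_of_pos hρ0 (-M)
    rcases le_total 1 (contourRadius ε μ s) with h | h
    · linarith [Real.rpow_le_rpow_of_exponent_le h hre.2]
    · linarith [Real.rpow_le_rpow_of_exponent_ge hρ0 h hre.1]
  rw [expRootMulCpow, norm_mul]
  calc _ ≤ ‖exp (contourParam ε μ s ^ ((1 / α : ℝ) : ℂ))‖ *
        ((contourRadius ε μ s ^ M + contourRadius ε μ s ^ (-M)) * Real.exp (Real.pi * M)) := by
        gcongr
        refine (norm_cpow_le_rpow_mul_exp _ _).trans ?_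
        rw [norm_contourParam hε]
        gcongr
    _ = (‖exp (contourParam ε μ s ^ ((1 / α : ℝ) : ℂ))‖ * contourRadius ε μ s ^ M +
        ‖exp (contourParam ε μ s ^ ((1 / α : ℝ) : ℂ))‖ * contourRadius ε μ s ^ (-M)) *
        Real.exp (Real.pi * M) := by ring
    _ ≤ (C₁ * (1 + ‖s‖) ^ (-2 : ℝ) + C₂ * (1 + ‖s‖) ^ (-2 : ℝ)) * Real.exp (Real.pi * M) := by
        exact mul_le_mul_of_nonneg_right (add_le_add (hC₁ s) (hC₂ s)) (Real.exp_pos _).le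
    _ = _ := by ring

theorem integrable_const_mul_one_add_norm_rpow (C : ℝ) :
    Integrable fun s : ℝ => C * (1 + ‖s‖) ^ (-2 : ℝ) :=
  (integrable_one_add_norm (by simp)).const_mul C

theorem integrable_expRootMulCpow_mul (hα : 0 < α) (hε : 0 < ε)
    (hμ1 : Real.pi * α / 2 < μ) (hμ2 : μ < α * Real.pi) (hμ : μ < Real.pi) (c : ℂ)
    {h : ℂ → ℂ} (hh : Measurable h) {K : ℝ} (hK : ∀ s, ‖h (contourParam ε μ s)‖ ≤ K) :
    Integrable fun s =>
      expRootMulCpow α c (contourParam ε μ s) * h (contourParam ε μ s) := by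
  obtain ⟨C, -, hC⟩ := exists_norm_expRootMulCpow_le hα hε hμ1 hμ2 hμ ‖c‖
  have hZ : Measurable (contourParam ε μ) := continuous_contourParam.measurable
  refine Integrable.mul_bdd ?_ (hh.comp hZ).aestronglyMeasurable (Eventually.of_forall hK)
  exact (integrable_const_mul_one_add_norm_rpow C).mono'
    ((measurable_expRootMulCpow α c).comp hZ).aestronglyMeasurable
    (Eventually.of_forall (hC c le_rfl))

theorem integrable_expRootMulCpow (hα : 0 < α) (hε : 0 < ε)
    (hμ1 : Real.pi * α / 2 < μ) (hμ2 : μ < α * Real.pi) (hμ : μ < Real.pi) (c : ℂ) :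
    Integrable fun s => expRootMulCpow α c (contourParam ε μ s) := by
  simpa using integrable_expRootMulCpow_mul hα hε hμ1 hμ2 hμ c (h := fun _ => 1)
    measurable_const (K := 1) (by simp)

end

section

/-! ### The Laplace transform of a power -/

/-- Both sides are holomorphic in `r` on the right half-plane and agree at the real points `1 +
1/(n+1)`, which accumulate at `1`. -/
theorem integral_cpow_mul_cexp_neg_mul_Ioi {a r : ℂ} (ha : 0 < a.re) (hr : 0 < r.re) :
    ∫ t : ℝ in Ioi 0, (t : ℂ) ^ (a - 1) * exp (-(r * t)) = (1 / r) ^ a * Gamma a := by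
  set U : Set ℂ := {r | 0 < r.re} with hU
  have hUo : IsOpen U := isOpen_lt continuous_const continuous_re
  have hUc : IsPreconnected U := (convex_halfSpace_re_gt 0).isPreconnected
  have hcont : ∀ p : ℂ, ContinuousOn (fun t : ℝ => (t : ℂ) ^ (a - 1) * exp (-(p * t))) (Ioi 0) := by
    intro p t ht
    refine (ContinuousAt.mul ?_ (by fun_prop)).continuousWithinAt
    exact continuousAt_ofReal_cpow_const _ _ (Or.inr (ne_of_gt ht))
  have hleft : DifferentiableOn ℂ
      (fun r : ℂ => ∫ t : ℝ in Ioi 0, (t : ℂ) ^ (a - 1) * exp (-(r * t))) U := by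
    refine differentiableOn_integral_of_locally_dominated hUo
      (fun p _ => (hcont p).aestronglyMeasurable measurableSet_Ioi)
      (Eventually.of_forall fun t => ?_) (fun p₀ hp₀ => ?_)
    · exact DifferentiableOn.mul (by fun_prop) (by fun_prop)
    · have hp₀' : 0 < p₀.re := hp₀
      refine ⟨fun t => t ^ (a.re - 1) * Real.exp (-(p₀.re / 2) * t ^ (1 : ℝ)),
        integrableOn_rpow_mul_exp_neg_mul_rpow (by linarith) one_pos (by linarith),
        {p | p₀.re / 2 < p.re}, (isOpen_lt continuous_const continuous_re).mem_nhds
          (show p₀.re / 2 < p₀.re by linarith), ?_⟩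
      filter_upwards [ae_restrict_mem measurableSet_Ioi] with t ht p hp
      have ht' : 0 < t := ht
      have hp' : p₀.re / 2 < p.re := hp
      rw [norm_mul, norm_cpow_eq_rpow_re_of_pos ht', norm_exp, sub_re, one_re, Real.rpow_one]
      gcongr
      rw [neg_re, re_mul_ofReal]
      nlinarith
  have hright : DifferentiableOn ℂ (fun r : ℂ => (1 / r) ^ a * Gamma a) U := by
    intro p hp
    have hp' : 0 < p.re := hp
    have hp0 : p ≠ 0 := by rintro rfl; simp at hp'
    refine (DifferentiableAt.mul_const ?_ _).differentiableWithinAt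
    refine DifferentiableAt.cpow_const ((differentiableAt_const _).div differentiableAt_id hp0) ?_
    left
    simp only [one_div, inv_re]
    exact div_pos hp' (normSq_pos.2 hp0)
  refine (hleft.analyticOnNhd hUo).eqOn_of_preconnected_of_frequently_eq
    (hright.analyticOnNhd hUo) hUc (show (1 : ℂ) ∈ U by simp [hU]) ?_ (show r ∈ U from hr)
  refine (tendsto_add_one_div_nhdsNE 1).frequently (Frequently.of_forall fun n => ?_)
  rw [← ofReal_one, ← ofReal_add]
  exact integral_cpow_mul_exp_neg_mul_Ioi ha (by positivity)

/-! ### Hankel's formula -/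

theorem ofReal_rpow_cpow {t : ℝ} (ht : 0 < t) (a : ℝ) (c : ℂ) :
    ((t ^ a : ℝ) : ℂ) ^ c = (t : ℂ) ^ (a * c) := by
  rw [cpow_def_of_ne_zero (ofReal_ne_zero.2 (Real.rpow_pos_of_pos ht a).ne'),
    cpow_def_of_ne_zero (ofReal_ne_zero.2 ht.ne'), ← ofReal_log (Real.rpow_nonneg ht.le a),
    ← ofReal_log ht.le, Real.log_rpow ht]
  push_cast
  ring_nf

variable {α μ : ℝ}

/-- Substituting `r = t^α` leaves the Laplace transform of `t^(-s)` at `-exp(iθ)`, where `θ = φ/α`.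
The choice of `τ`, which is `±π` in use, makes `τ - θ` the principal argument of the reciprocal of
`-exp(iθ)`. -/
theorem integral_expRootMulCpow_ray (hα : 0 < α) {φ τ : ℝ}
    (hφ : φ ∈ Ioc (-Real.pi) Real.pi) (hτ : exp (τ * I) = -1) (hτφ : |τ - φ / α| < Real.pi / 2)
    {s : ℂ} (hs : s.re < 1) :
    ∫ r in Ioi (0 : ℝ), expRootMulCpow α ((1 - s) / α - 1) (polarPoint r φ) * exp ((φ : ℂ) * I) =
      α * exp (τ * I * (1 - s)) * Gamma (1 - s) := by
  have hα0 : (α : ℂ) ≠ 0 := ofReal_ne_zero.2 hα.ne'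
  have hpi := Real.pi_pos
  rw [← integral_comp_rpow_Ioi_of_pos hα]
  set θ : ℝ := φ / α with hθ
  have hrot : exp ((θ : ℂ) * I) = -exp (((θ - τ : ℝ) : ℂ) * I) := by
    rw [ofReal_sub, sub_mul, exp_sub, hτ, div_neg, div_one, neg_neg]
  have hre : 0 < (-exp ((θ : ℂ) * I)).re := by
    rw [hrot, neg_neg, exp_ofReal_mul_I_re]
    refine Real.cos_pos_of_mem_Ioo ?_
    rw [abs_lt] at hτφ
    exact ⟨by linarith, by linarith⟩
  have hcongr : ∀ t ∈ Ioi (0 : ℝ), (α * t ^ (α - 1)) •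
      (expRootMulCpow α ((1 - s) / α - 1) (polarPoint (t ^ α) φ) * exp ((φ : ℂ) * I)) =
      (α * exp ((θ : ℂ) * I * (1 - s))) *
        ((t : ℂ) ^ ((1 - s) - 1) * exp (-(-exp ((θ : ℂ) * I) * t))) := by
    intro t ht
    have ht' : 0 < t := ht
    have htC : (t : ℂ) ≠ 0 := ofReal_ne_zero.2 ht'.ne'
    have hta : 0 < t ^ α := Real.rpow_pos_of_pos ht' α
    rw [expRootMulCpow, polarPoint_cpow hta hφ, polarPoint_cpow hta hφ, ofReal_rpow_cpow ht',
      ofReal_rpow_cpow ht', real_smul]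
    have e1 : (α : ℂ) * ((1 / α : ℝ) : ℂ) = 1 := by push_cast; field_simp
    have e2 : (φ : ℂ) * I * ((1 / α : ℝ) : ℂ) = (θ : ℂ) * I := by rw [hθ]; push_cast; ring
    have e3 : exp ((θ : ℂ) * I * (1 - s)) =
        exp ((φ : ℂ) * I * ((1 - s) / α - 1)) * exp ((φ : ℂ) * I) := by
      rw [← exp_add, hθ]; push_cast; congr 1; field_simp; ring
    have e4 : (t : ℂ) ^ ((1 - s) - 1) = (t : ℂ) ^ ((α : ℂ) - 1) * (t : ℂ) ^ (α * ((1 - s) / α - 1)) := by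
      rw [← cpow_add _ _ htC]; congr 1; field_simp; ring
    rw [e1, e2, e3, e4, cpow_one, ofReal_mul, ofReal_cpow ht'.le, ofReal_sub, ofReal_one,
      neg_mul, neg_neg, mul_comm (t : ℂ) (exp _)]
    ring
  rw [setIntegral_congr_fun measurableSet_Ioi hcongr, integral_const_mul,
    integral_cpow_mul_cexp_neg_mul_Ioi (by simpa using hs) hre]
  have hinv : 1 / -exp ((θ : ℂ) * I) = polarPoint 1 (τ - θ) := by
    rw [hrot, neg_neg, one_div, ← exp_neg, polarPoint, ofReal_one, one_mul]
    push_cast; ring_nf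
  rw [hinv, polarPoint_cpow one_pos ⟨by linarith [(abs_lt.1 hτφ).1], by linarith [(abs_lt.1 hτφ).2]⟩]
  have : exp ((τ : ℂ) * I * (1 - s)) =
      exp ((θ : ℂ) * I * (1 - s)) * exp (((τ - θ : ℝ) : ℂ) * I * (1 - s)) := by
    rw [← exp_add]; push_cast; ring_nf
  rw [this, ofReal_one, one_cpow]
  ring

theorem integrableOn_expRootMulCpow_ray (hα : 0 < α) {φ : ℝ}
    (hφ : φ ∈ Ioc (-Real.pi) Real.pi) (hcos : Real.cos (φ / α) < 0) {c : ℂ} (hc : -1 < c.re) :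
    IntegrableOn (fun r => expRootMulCpow α c (polarPoint r φ)) (Ioi 0) := by
  have hdom := (integrableOn_rpow_mul_exp_neg_mul_rpow hc (one_div_pos.2 hα)
    (neg_pos.2 hcos)).mul_const (Real.exp (Real.pi * ‖c‖))
  refine Integrable.mono' hdom ?_ ?_
  · have : Measurable fun r => polarPoint r φ := by unfold polarPoint; fun_prop
    exact ((measurable_expRootMulCpow α c).comp this).aestronglyMeasurable
  · filter_upwards [ae_restrict_mem measurableSet_Ioi] with r hr
    have hr' : 0 < r := hr
    have := norm_cpow_le_rpow_mul_exp (polarPoint r φ) c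
    rw [norm_polarPoint hr'.le] at this
    rw [expRootMulCpow, norm_mul, norm_exp_polarPoint_cpow hr' hφ]
    calc _ ≤ Real.exp (r ^ (1 / α) * Real.cos (φ / α)) *
          (r ^ c.re * Real.exp (Real.pi * ‖c‖)) := by gcongr
      _ = _ := by rw [neg_neg, mul_comm (Real.cos _)]; ring

theorem tendsto_setIntegral_Ioi_one_div {f : ℝ → ℂ} (hf : IntegrableOn f (Ioi 0)) :
    Tendsto (fun n : ℕ => ∫ r in Ioi (1 / ((n : ℝ) + 1)), f r) atTop (𝓝 (∫ r in Ioi 0, f r)) := by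
  have hU : ⋃ n : ℕ, Ioi (1 / ((n : ℝ) + 1)) = Ioi (0 : ℝ) := by
    ext x
    simp only [mem_iUnion, mem_Ioi]
    constructor
    · rintro ⟨n, hn⟩
      exact lt_trans (by positivity) hn
    · exact fun hx => exists_nat_one_div_lt hx
  rw [← hU] at hf ⊢
  refine tendsto_setIntegral_of_monotone (fun n => measurableSet_Ioi) ?_ hf
  intro m n hmn
  exact Ioi_subset_Ioi (one_div_le_one_div_of_le (by positivity) (by gcongr))

theorem tendsto_integral_expRootMulCpow_arc (hα : 0 < α) (hμ0 : 0 ≤ μ) (hμ : μ < Real.pi) {c : ℂ}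
    (hc : -1 < c.re) :
    Tendsto (fun n : ℕ => ∫ φ in (-μ)..μ, expRootMulCpow α c (polarPoint (1 / ((n : ℝ) + 1)) φ) *
      (I * polarPoint (1 / ((n : ℝ) + 1)) φ)) atTop (𝓝 0) := by
  have hlim : Tendsto (fun n : ℕ => Real.exp 1 * Real.exp (Real.pi * ‖c‖) *
      (1 / ((n : ℝ) + 1)) ^ (c.re + 1) * |μ - -μ|) atTop (𝓝 0) := by
    have h1 : Tendsto (fun n : ℕ => (1 / ((n : ℝ) + 1)) ^ (c.re + 1)) atTop (𝓝 0) := by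
      have := tendsto_one_div_add_atTop_nhds_zero_nat (𝕜 := ℝ)
      have h2 := this.rpow_const (p := c.re + 1) (Or.inr (by linarith))
      rwa [Real.zero_rpow (by linarith)] at h2
    simpa using (h1.const_mul (Real.exp 1 * Real.exp (Real.pi * ‖c‖))).mul_const |μ - -μ|
  refine squeeze_zero_norm (fun n => ?_) hlim
  set r : ℝ := 1 / ((n : ℝ) + 1) with hr
  have hr0 : 0 < r := by positivity
  have hr1 : r ≤ 1 := by
    rw [hr, div_le_one (by positivity)]; linarith [(Nat.cast_nonneg n : (0 : ℝ) ≤ n)]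
  refine intervalIntegral.norm_integral_le_of_norm_le_const fun φ hφ => ?_
  rw [uIoc_of_le (by linarith)] at hφ
  have hφ' : φ ∈ Ioc (-Real.pi) Real.pi := ⟨by linarith [hφ.1], by linarith [hφ.2]⟩
  have h1 := norm_cpow_le_rpow_mul_exp (polarPoint r φ) c
  rw [norm_polarPoint hr0.le] at h1
  rw [norm_mul, norm_mul, norm_I, one_mul, norm_polarPoint hr0.le, expRootMulCpow, norm_mul,
    norm_exp_polarPoint_cpow hr0 hφ', Real.rpow_add_one hr0.ne']
  have h2 : Real.exp (r ^ (1 / α) * Real.cos (φ / α)) ≤ Real.exp 1 := by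
    rw [Real.exp_le_exp]
    have h3 : r ^ (1 / α) ≤ 1 := Real.rpow_le_one hr0.le hr1 (by positivity)
    have h4 : 0 ≤ r ^ (1 / α) := by positivity
    nlinarith [Real.cos_le_one (φ / α)]
  calc _ ≤ Real.exp 1 * (r ^ c.re * Real.exp (Real.pi * ‖c‖)) * r := by gcongr
    _ = _ := by ring

/-- By Cauchy the integral does not depend on the radius. Since `Re s < 1` makes the real part of
the exponent exceed `-1`, the arc contributes nothing in the limit of radius `0`, and the rays give
`2iα sin(πs) Γ(1 - s)`. -/
theorem contourIntegral_expRootMulCpow_of_re_lt_one (hα : 0 < α) {ε : ℝ} (hε : 0 < ε)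
    (hμ1 : Real.pi * α / 2 < μ) (hμ2 : μ < α * Real.pi) (hμ : μ < Real.pi) {s : ℂ}
    (hs : s.re < 1) :
    contourIntegral ε μ (expRootMulCpow α ((1 - s) / α - 1)) =
      2 * Real.pi * I * α * (Gamma s)⁻¹ := by
  have hpi := Real.pi_pos
  have hμ0 : 0 < μ := lt_trans (by positivity) hμ1
  have hμα1 : Real.pi / 2 < μ / α := by rw [lt_div_iff₀ hα]; linarith
  have hμα2 : μ / α < Real.pi := by rw [div_lt_iff₀ hα]; linarith
  have hcos := cos_div_neg hα hμ1 hμ2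
  set c := (1 - s) / (α : ℂ) - 1 with hc
  have hcre : -1 < c.re := by
    rw [hc, sub_re, one_re, div_ofReal_re, sub_re, one_re]
    have : 0 < (1 - s.re) / α := div_pos (by linarith) hα
    linarith
  have hconst : ∀ r R : ℝ, 0 < r → r ≤ R →
      contourIntegral R μ (expRootMulCpow α c) = contourIntegral r μ (expRootMulCpow α c) := by
    intro r R hr hrR
    rw [← sub_eq_zero, contourIntegral_sub_contourIntegral hrR
      (contourIntegrable_of_integrable hμ0 (integrable_expRootMulCpow hα hr hμ1 hμ2 hμ c)),
      sectorIntegral_eq_zero_of_differentiableOn hr hrR hμ0.le hμ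
        (differentiableOn_expRootMulCpow α c)]
  have m1 : μ ∈ Ioc (-Real.pi) Real.pi := ⟨by linarith, hμ.le⟩
  have m2 : -μ ∈ Ioc (-Real.pi) Real.pi := ⟨by linarith, by linarith⟩
  have t1 := tendsto_setIntegral_Ioi_one_div
    ((integrableOn_expRootMulCpow_ray hα m1 hcos hcre).mul_const (exp ((μ : ℂ) * I)))
  have t2 := tendsto_setIntegral_Ioi_one_div
    ((integrableOn_expRootMulCpow_ray hα m2 (by rwa [neg_div, Real.cos_neg]) hcre).mul_const
      (exp (((-μ : ℝ) : ℂ) * I)))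
  have t3 := tendsto_integral_expRootMulCpow_arc hα hμ0.le hμ hcre
  rw [hc, integral_expRootMulCpow_ray hα m1 (τ := Real.pi) exp_pi_mul_I
    (abs_lt.2 ⟨by linarith, by linarith⟩) hs, ← hc] at t1
  rw [hc, integral_expRootMulCpow_ray hα m2 (τ := -Real.pi)
    (by rw [ofReal_neg, neg_mul, exp_neg, exp_pi_mul_I]; norm_num)
    (by rw [neg_div]; exact abs_lt.2 ⟨by linarith, by linarith⟩) hs, ← hc] at t2
  have t := (t2.neg.add t3).add t1
  have hev : ∀ᶠ n : ℕ in atTop, contourIntegral (1 / ((n : ℝ) + 1)) μ (expRootMulCpow α c) =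
      contourIntegral ε μ (expRootMulCpow α c) := by
    have := (tendsto_one_div_add_atTop_nhds_zero_nat (𝕜 := ℝ)).eventually (eventually_le_nhds hε)
    filter_upwards [this] with n hn
    exact (hconst _ _ (by positivity) hn).symm
  have huniq := tendsto_nhds_unique (tendsto_const_nhds.congr' (hev.mono fun n hn => hn.symm)) t
  rw [huniq]
  have hsin : exp ((Real.pi : ℂ) * I * (1 - s)) - exp (((-Real.pi : ℝ) : ℂ) * I * (1 - s)) =
      2 * I * sin (Real.pi * s) := by
    have h1 : sin (Real.pi * s) = sin (Real.pi * (1 - s)) := by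
      rw [mul_sub, mul_one, sin_pi_sub]
    rw [h1, sin]
    push_cast
    rw [show -((Real.pi : ℂ) * (1 - s)) * I = -(Real.pi : ℂ) * I * (1 - s) by ring,
      show (Real.pi : ℂ) * (1 - s) * I = (Real.pi : ℂ) * I * (1 - s) by ring]
    linear_combination (exp ((Real.pi : ℂ) * I * (1 - s)) -
      exp (-(Real.pi : ℂ) * I * (1 - s))) * I_sq
  have hG : Gamma (1 - s) ≠ 0 := Gamma_ne_zero_of_re_pos (by simpa using hs)
  have hrefl : sin (Real.pi * s) * Gamma (1 - s) = Real.pi * (Gamma s)⁻¹ := by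
    have h := Gamma_mul_Gamma_one_sub s
    -- At a zero of the sine the reflection formula reads `Γ(s) Γ(1 - s) = π / 0 = 0`, which forces
    -- the default value `Γ(s) = 0`; both sides then vanish.
    by_cases h0 : sin (Real.pi * s) = 0
    · rw [h0, div_zero] at h
      rw [h0, (mul_eq_zero.1 h).resolve_right hG]
      simp
    · have hGs : Gamma s ≠ 0 := by
        intro h1
        rw [h1, zero_mul, eq_comm, div_eq_zero_iff] at h
        exact h.elim (ofReal_ne_zero.2 hpi.ne') h0
      rw [eq_div_iff h0] at h
      field_simp
      linear_combination h
  linear_combination (α * Gamma (1 - s)) * hsin + (α * 2 * I) * hrefl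

/-- **Hankel's formula** for the reciprocal of the Gamma function, on the contour `γ(ε, μ)`. -/
theorem contourIntegral_expRootMulCpow (hα : 0 < α) {ε : ℝ} (hε : 0 < ε)
    (hμ1 : Real.pi * α / 2 < μ) (hμ2 : μ < α * Real.pi) (hμ : μ < Real.pi) (s : ℂ) :
    contourIntegral ε μ (expRootMulCpow α ((1 - s) / α - 1)) =
      2 * Real.pi * I * α * (Gamma s)⁻¹ := by
  have hpi := Real.pi_pos
  have hμ0 : 0 < μ := lt_trans (by positivity) hμ1
  have hα0 : (α : ℂ) ≠ 0 := ofReal_ne_zero.2 hα.ne'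
  have hZ : Measurable (contourParam ε μ) := continuous_contourParam.measurable
  have hint : ∀ c, Integrable fun s => expRootMulCpow α c (contourParam ε μ s) :=
    integrable_expRootMulCpow hα hε hμ1 hμ2 hμ
  have hleft : DifferentiableOn ℂ (fun s : ℂ => ∫ x, expRootMulCpow α ((1 - s) / α - 1)
      (contourParam ε μ x) * contourVelocity ε μ x) univ := by
    refine differentiableOn_integral_of_locally_dominated isOpen_univ
      (fun p _ => (integrable_mul_contourVelocity hε (hint _)).aestronglyMeasurable)
      (Eventually.of_forall fun x => ?_) (fun p₀ _ => ?_)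
    · have h0 := slitPlane_ne_zero (contourParam_mem_slitPlane hε hμ0 hμ x)
      have h1 : Differentiable ℂ fun s : ℂ => contourParam ε μ x ^ ((1 - s) / α - 1) :=
        Differentiable.const_cpow (by fun_prop) (Or.inl h0)
      exact ((h1.const_mul _).mul_const _).differentiableOn
    · obtain ⟨C, hC0, hC⟩ := exists_norm_expRootMulCpow_le hα hε hμ1 hμ2 hμ
        (‖(1 - p₀) / (α : ℂ) - 1‖ + 1)
      refine ⟨_, (integrable_const_mul_one_add_norm_rpow C).mul_const (1 + ε),
        {p | ‖(1 - p) / (α : ℂ) - 1‖ < ‖(1 - p₀) / (α : ℂ) - 1‖ + 1},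
        (isOpen_lt (by fun_prop) continuous_const).mem_nhds (by simp), ?_⟩
      refine Eventually.of_forall fun x p hp => ?_
      rw [norm_mul]
      gcongr
      exacts [hC _ (le_of_lt hp) x, norm_contourVelocity_le hε x]
  have hright : Differentiable ℂ fun s : ℂ => 2 * Real.pi * I * α * (Gamma s)⁻¹ :=
    differentiable_one_div_Gamma.const_mul _
  -- Both sides are entire in `s` and agree on the half-plane `Re s < 1`, a neighbourhood of `0`.
  have := (hleft.analyticOnNhd isOpen_univ).eqOn_of_preconnected_of_eventuallyEq
    (hright.differentiableOn.analyticOnNhd isOpen_univ) isPreconnected_univ (mem_univ (0 : ℂ)) ?_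
    (mem_univ s)
  · rw [contourIntegral_eq_integral hε hμ0 (hint _)]
    exact this
  · filter_upwards [(isOpen_lt continuous_re continuous_const).mem_nhds
      (show (0 : ℂ).re < 1 by simp)] with p hp
    rw [← contourIntegral_eq_integral hε hμ0 (hint _)]
    exact contourIntegral_expRootMulCpow_of_re_lt_one hα hε hμ1 hμ2 hμ hp

end

section

/-! ### The regions on the two sides of the contour -/

variable {α δ ε μ : ℝ} {β : ℂ}

/-- Monotonicity of the cosine on `[0, π]` replaces the discontinuous argument by continuous
functions, which makes openness of the regions evident. -/
theorem abs_arg_lt_iff (hμ0 : 0 ≤ μ) (hμ : μ ≤ Real.pi) {z : ℂ} (hz : z ≠ 0) :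
    |z.arg| < μ ↔ ‖z‖ * Real.cos μ < z.re := by
  rw [← norm_mul_cos_arg z, mul_lt_mul_iff_right₀ (norm_pos_iff.2 hz), ← Real.cos_abs z.arg]
  exact (Real.strictAntiOn_cos.lt_iff_gt ⟨hμ0, hμ⟩ ⟨abs_nonneg _, abs_arg_le_pi z⟩).symm

theorem lt_abs_arg_iff (hμ0 : 0 ≤ μ) (hμ : μ ≤ Real.pi) {z : ℂ} :
    μ < |z.arg| ↔ z.re < ‖z‖ * Real.cos μ := by
  rcases eq_or_ne z 0 with rfl | hz
  · simpa using hμ0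
  · rw [← norm_mul_cos_arg z, mul_lt_mul_iff_right₀ (norm_pos_iff.2 hz), ← Real.cos_abs z.arg]
    exact (Real.strictAntiOn_cos.lt_iff_gt ⟨abs_nonneg _, abs_arg_le_pi z⟩ ⟨hμ0, hμ⟩).symm

theorem leftRegion_eq (hμ0 : 0 ≤ μ) (hμ : μ ≤ Real.pi) :
    leftRegion ε μ = {z | ‖z‖ < ε ∨ z.re < ‖z‖ * Real.cos μ} := by
  simp only [leftRegion, lt_abs_arg_iff hμ0 hμ]

theorem isOpen_leftRegion (hμ0 : 0 ≤ μ) (hμ : μ ≤ Real.pi) : IsOpen (leftRegion ε μ) := by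
  rw [leftRegion_eq hμ0 hμ]
  exact (isOpen_lt continuous_norm continuous_const).union
    (isOpen_lt continuous_re (continuous_norm.mul continuous_const))

theorem isOpen_rightRegion (hε : 0 < ε) (hμ0 : 0 ≤ μ) (hμ : μ ≤ Real.pi) :
    IsOpen (rightRegion ε μ) := by
  have : rightRegion ε μ = {z | ε < ‖z‖} ∩ {z | ‖z‖ * Real.cos μ < z.re} := by
    ext z
    refine and_congr_right fun h => ?_
    exact abs_arg_lt_iff hμ0 hμ (norm_pos_iff.1 (hε.trans h))
  rw [this]
  exact (isOpen_lt continuous_const continuous_norm).inter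
    (isOpen_lt (continuous_norm.mul continuous_const) continuous_re)

theorem zero_mem_leftRegion (hε : 0 < ε) : (0 : ℂ) ∈ leftRegion ε μ := by
  left; simpa using hε

/-- The region is star-shaped about `0`: scaling by `a ∈ (0, 1]` does not increase the modulus and
keeps the argument. -/
theorem isPreconnected_leftRegion (hε : 0 < ε) :
    IsPreconnected (leftRegion ε μ) := by
  have hstar : StarConvex ℝ (0 : ℂ) (leftRegion ε μ) := by
    rw [starConvex_zero_iff]
    intro z hz a ha0 ha1
    rcases ha0.eq_or_lt with rfl | ha
    · rw [zero_smul]; exact zero_mem_leftRegion hε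
    · rcases hz with hz | hz
      · left
        rw [norm_smul, Real.norm_eq_abs, abs_of_pos ha]
        exact (mul_le_of_le_one_left (norm_nonneg _) ha1).trans_lt hz
      · right
        rwa [real_smul, arg_real_mul _ ha]
  exact (hstar.isPathConnected (zero_mem_leftRegion hε)).isConnected.isPreconnected

theorem disjoint_leftRegion_contourSet : Disjoint (leftRegion ε μ) (contourSet ε μ) := by
  rw [disjoint_left]
  rintro z (h | h) (⟨h1, h2⟩ | ⟨h1, h2⟩) <;> linarith

theorem disjoint_rightRegion_contourSet : Disjoint (rightRegion ε μ) (contourSet ε μ) := by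
  rw [disjoint_left]
  rintro z ⟨h3, h4⟩ (⟨h1, h2⟩ | ⟨h1, h2⟩) <;> linarith

theorem one_sub_div_mem_slitPlane_of_mem_leftRegion (hε : 0 < ε) {z ζ : ℂ}
    (hz : z ∈ leftRegion ε μ) (hζ : ζ ∈ contourSet ε μ) : 1 - z / ζ ∈ slitPlane := by
  have h : ε ≤ ‖ζ‖ ∧ |ζ.arg| ≤ μ := by
    rcases hζ with ⟨h1, h2⟩ | ⟨h1, h2⟩
    exacts [⟨h1.ge, h2⟩, ⟨h1, h2.le⟩]
  refine one_sub_div_mem_slitPlane (norm_pos_iff.1 (hε.trans_le h.1)) ?_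
  rcases hz with hz | hz
  · exact Or.inl (hz.trans_le h.1)
  · refine Or.inr fun he => ?_
    rw [he] at hz
    linarith [h.2]

/-- This bounds `(1 - z/ζ)^(-δ)` along the whole unbounded contour, locally uniformly in `z`. Far
out `‖z/ζ‖ ≤ 1/2`; for bounded `ζ` the distance from `z` to the contour is bounded below. -/
theorem exists_le_norm_one_sub_div {U : Set ℂ} (hU : IsOpen U) (hε : 0 < ε)
    (hd : Disjoint U (contourSet ε μ)) {z₀ : ℂ} (hz₀ : z₀ ∈ U) :
    ∃ m > 0, ∃ V ∈ 𝓝 z₀, ∀ z ∈ V, ∀ ζ ∈ contourSet ε μ, m ≤ ‖1 - z / ζ‖ := by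
  obtain ⟨η, hη, hηU⟩ := Metric.isOpen_iff.1 hU z₀ hz₀
  set N := ‖z₀‖ + η with hN
  have hN0 : 0 < N := by positivity
  refine ⟨min (1 / 2) (η / 2 / (2 * N)), by positivity, Metric.ball z₀ (η / 2),
    Metric.ball_mem_nhds _ (by positivity), fun z hz ζ hζ => ?_⟩
  rw [Metric.mem_ball, dist_eq_norm] at hz
  have hζε : ε ≤ ‖ζ‖ := by
    rcases hζ with ⟨h1, -⟩ | ⟨h1, -⟩
    exacts [h1.ge, h1]
  have hζ0 : 0 < ‖ζ‖ := hε.trans_le hζε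
  have hzN : ‖z‖ ≤ N := by
    have := norm_le_norm_add_norm_sub' z z₀
    linarith
  rcases le_or_gt ‖ζ‖ (2 * N) with h | h
  · have h1 : η ≤ ‖ζ - z₀‖ := by
      by_contra hlt
      push Not at hlt
      exact disjoint_left.1 hd (hηU (by rwa [Metric.mem_ball, dist_eq_norm])) hζ
    have h2 : η / 2 ≤ ‖ζ - z‖ := by
      have h3 : ζ - z₀ = (ζ - z) + (z - z₀) := by ring
      have := norm_add_le (ζ - z) (z - z₀)
      rw [← h3] at this
      linarith
    have h4 : 1 - z / ζ = (ζ - z) / ζ := by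
      rw [sub_div, div_self (norm_pos_iff.1 hζ0)]
    rw [h4, norm_div]
    refine (min_le_right _ _).trans ?_
    gcongr
  · refine (min_le_left _ _).trans ?_
    have h1 : ‖z / ζ‖ ≤ 1 / 2 := by
      rw [norm_div, div_le_iff₀ hζ0]; linarith
    have := norm_sub_norm_le (1 : ℂ) (z / ζ)
    rw [norm_one] at this
    linarith

/-! ### The Prabhakar integrand -/

theorem differentiableOn_prabhakarG : DifferentiableOn ℂ (prabhakarG α δ β) slitPlane :=
  differentiableOn_expRootMulCpow α _

theorem prabhakarG_div_shiftPow (z : ℂ) {ζ : ℂ} (hζ : ζ ≠ 0) :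
    prabhakarG α δ β ζ / shiftPow δ z ζ =
      expRootMulCpow α ((1 - β) / α - 1) ζ * ((1 - z / ζ) ^ (δ : ℂ))⁻¹ := by
  have h : ζ ^ ((1 - β) / (α : ℂ) + δ - 1) = ζ ^ ((1 - β) / (α : ℂ) - 1) * ζ ^ (δ : ℂ) := by
    rw [← cpow_add _ _ hζ]; congr 1; ring
  have h0 : ζ ^ (δ : ℂ) ≠ 0 := by simp [cpow_eq_zero_iff, hζ]
  rw [prabhakarG, shiftPow, expRootMulCpow, h, ← mul_assoc, mul_comm _ (ζ ^ (δ : ℂ)),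
    mul_div_mul_left _ _ h0, div_eq_mul_inv]

theorem shiftPow_natCast {n : ℕ} (hn : δ = n) (z : ℂ) {ζ : ℂ} (hζ : ζ ≠ 0) :
    shiftPow δ z ζ = (ζ - z) ^ n := by
  rw [shiftPow, hn, ofReal_natCast, cpow_natCast, cpow_natCast, ← mul_pow, mul_sub, mul_one,
    mul_div_cancel₀ _ hζ]

/-- For real `δ` the modulus of `w^δ` is `‖w‖^δ` even across the cut, so only the distance from `z`
to the contour matters and the result serves both sides of it. -/
theorem integrable_prabhakarG_div_shiftPow (hα : 0 < α) (hδ : 0 ≤ δ) (hε : 0 < ε)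
    (hμ1 : Real.pi * α / 2 < μ) (hμ2 : μ < α * Real.pi) (hμ : μ < Real.pi) {U : Set ℂ}
    (hU : IsOpen U) (hd : Disjoint U (contourSet ε μ)) {z : ℂ} (hz : z ∈ U) :
    Integrable fun s =>
      prabhakarG α δ β (contourParam ε μ s) / shiftPow δ z (contourParam ε μ s) := by
  have hμ0 : 0 < μ := lt_trans (by have := Real.pi_pos; positivity) hμ1
  obtain ⟨m, hm, V, hV, hle⟩ := exists_le_norm_one_sub_div hU hε hd hz
  have hmeas : Measurable fun ζ : ℂ => ((1 - z / ζ) ^ (δ : ℂ))⁻¹ := by fun_prop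
  refine (integrable_expRootMulCpow_mul hα hε hμ1 hμ2 hμ ((1 - β) / α - 1) hmeas
    (K := (m ^ δ)⁻¹) fun s => ?_).congr (Eventually.of_forall fun s => ?_)
  · rw [norm_inv, norm_cpow_real]
    gcongr
    exact hle z (mem_of_mem_nhds hV) _ (contourParam_mem_contourSet hε hμ0 hμ s)
  · exact (prabhakarG_div_shiftPow z
      (slitPlane_ne_zero (contourParam_mem_slitPlane hε hμ0 hμ s))).symm

theorem differentiableOn_contourIntegral_prabhakarG_div_shiftPow (hα : 0 < α) (hδ : 0 ≤ δ)
    (hε : 0 < ε) (hμ1 : Real.pi * α / 2 < μ) (hμ2 : μ < α * Real.pi) (hμ : μ < Real.pi) :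
    DifferentiableOn ℂ
      (fun z => contourIntegral ε μ fun ζ => prabhakarG α δ β ζ / shiftPow δ z ζ)
      (leftRegion ε μ) := by
  have hμ0 : 0 < μ := lt_trans (by have := Real.pi_pos; positivity) hμ1
  have hU : IsOpen (leftRegion ε μ) := isOpen_leftRegion hμ0.le hμ.le
  have hZ0 := fun s => slitPlane_ne_zero (contourParam_mem_slitPlane hε hμ0 hμ s)
  have hZc := contourParam_mem_contourSet hε hμ0 hμ
  have hint : ∀ z ∈ leftRegion ε μ, Integrable fun s =>
      prabhakarG α δ β (contourParam ε μ s) / shiftPow δ z (contourParam ε μ s) := fun z hz =>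
    integrable_prabhakarG_div_shiftPow hα hδ hε hμ1 hμ2 hμ hU disjoint_leftRegion_contourSet hz
  refine DifferentiableOn.congr ?_ fun z hz => contourIntegral_eq_integral
    (f := fun ζ => prabhakarG α δ β ζ / shiftPow δ z ζ) hε hμ0 (hint z hz)
  refine differentiableOn_integral_of_locally_dominated hU
    (fun z hz => (integrable_mul_contourVelocity
      (f := fun ζ => prabhakarG α δ β ζ / shiftPow δ z ζ) hε (hint z hz)).aestronglyMeasurable)
    (Eventually.of_forall fun s => ?_) (fun z₀ hz₀ => ?_)
  · refine DifferentiableOn.mul_const ?_ _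
    simp only [prabhakarG_div_shiftPow _ (hZ0 s)]
    refine DifferentiableOn.const_mul (DifferentiableOn.inv ?_ fun z hz => ?_) _
    · intro z hz
      refine (DifferentiableAt.cpow_const (by fun_prop) ?_).differentiableWithinAt
      exact one_sub_div_mem_slitPlane_of_mem_leftRegion hε hz (hZc s)
    · have := slitPlane_ne_zero (one_sub_div_mem_slitPlane_of_mem_leftRegion hε hz (hZc s))
      simp [cpow_eq_zero_iff, this]
  · obtain ⟨m, hm, V, hV, hle⟩ :=
      exists_le_norm_one_sub_div hU hε disjoint_leftRegion_contourSet hz₀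
    refine ⟨fun s => ‖expRootMulCpow α ((1 - β) / α - 1) (contourParam ε μ s)‖ * (m ^ δ)⁻¹ *
      (1 + ε), ((integrable_expRootMulCpow hα hε hμ1 hμ2 hμ _).norm.mul_const _).mul_const _,
      V, hV, Eventually.of_forall fun s z hz => ?_⟩
    rw [norm_mul, prabhakarG_div_shiftPow _ (hZ0 s), norm_mul, norm_inv, norm_cpow_real]
    beta_reduce
    gcongr
    exacts [hle z hz _ (hZc s), norm_contourVelocity_le hε s]

/-! ### Termwise integration -/

theorem hasSum_ascPochhammer_div_factorial_mul_pow (a : ℂ) {w : ℂ} (hw : ‖w‖ < 1) :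
    HasSum (fun n : ℕ => (ascPochhammer ℂ n).eval a / n.factorial * w ^ n) ((1 - w) ^ a)⁻¹ := by
  have h := (one_div_one_sub_cpow_hasFPowerSeriesOnBall_zero a).hasSum (y := w)
    (by simpa [enorm_eq_nnnorm, ← NNReal.coe_lt_coe] using hw)
  simp only [FormalMultilinearSeries.ofScalars_apply_eq, zero_add, one_div, smul_eq_mul] at h
  refine h.congr_fun fun n => ?_
  congr 1
  -- The coefficient `Ring.choose (a + n - 1) n` is the multichoose number of `a`, that is `(a)ₙ /
  -- n!`.
  have h1 := Ring.factorial_nsmul_multichoose_eq_ascPochhammer a n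
  rw [Polynomial.ascPochhammer_smeval_eq_eval, nsmul_eq_mul] at h1
  have hf : (n.factorial : ℂ) ≠ 0 := by exact_mod_cast n.factorial_ne_zero
  rw [← h1, mul_div_cancel_left₀ _ hf, Ring.choose]
  congr 1
  ring

/-- Expand `(1 - z/ζ)^(-δ)` and integrate termwise: `ζ^(-n)` moves the parameter of Hankel's formula
from `β` to `αn + β`. The interchange is dominated by the absolutely convergent binomial series at
`‖z‖/ε`, as `‖ζ‖ ≥ ε` on the contour. -/
theorem hasSum_prabhakarTerm (hα : 0 < α) (hδ : 0 ≤ δ) (hε : 0 < ε)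
    (hμ1 : Real.pi * α / 2 < μ) (hμ2 : μ < α * Real.pi) (hμ : μ < Real.pi) {z : ℂ}
    (hz : ‖z‖ < ε) :
    HasSum (prabhakarTerm α β δ z) (1 / (2 * (Real.pi : ℂ) * (α : ℂ) * I) *
      contourIntegral ε μ fun ζ => prabhakarG α δ β ζ / shiftPow δ z ζ) := by
  have hμ0 : 0 < μ := lt_trans (by have := Real.pi_pos; positivity) hμ1
  have hα0 : (α : ℂ) ≠ 0 := ofReal_ne_zero.2 hα.ne'
  have hZ0 := fun s => slitPlane_ne_zero (contourParam_mem_slitPlane hε hμ0 hμ s)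
  have hzU : z ∈ leftRegion ε μ := Or.inl hz
  set k : ℂ → ℂ := expRootMulCpow α ((1 - β) / α - 1) with hk
  set a : ℕ → ℂ := fun n => (ascPochhammer ℂ n).eval (δ : ℂ) / n.factorial with ha
  have hkn : ∀ (n : ℕ) (ζ : ℂ), ζ ≠ 0 →
      expRootMulCpow α ((1 - (α * n + β)) / α - 1) ζ = k ζ * (ζ ^ n)⁻¹ := by
    intro n ζ hζ
    have : (1 - (α * n + β)) / (α : ℂ) - 1 = ((1 - β) / α - 1) - n := by field_simp; ring
    rw [hk, expRootMulCpow, expRootMulCpow, this, cpow_sub _ _ hζ, cpow_natCast, mul_div_assoc',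
      div_eq_mul_inv]
  have hkint : Integrable fun s => k (contourParam ε μ s) :=
    integrable_expRootMulCpow hα hε hμ1 hμ2 hμ _
  have hkW := integrable_mul_contourVelocity hε hkint
  have hterm : ∀ n : ℕ, ∫ s, a n * z ^ n * (k (contourParam ε μ s) *
      (contourParam ε μ s ^ n)⁻¹ * contourVelocity ε μ s) =
      2 * Real.pi * I * α * prabhakarTerm α β δ z n := by
    intro n
    have hH := contourIntegral_expRootMulCpow hα hε hμ1 hμ2 hμ (α * n + β)
    rw [contourIntegral_eq_integral hε hμ0 (integrable_expRootMulCpow hα hε hμ1 hμ2 hμ _)] at hH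
    simp only [fun s => hkn n _ (hZ0 s)] at hH
    rw [integral_const_mul, hH, prabhakarTerm, ha]
    simp only [div_eq_mul_inv, mul_inv]
    ring
  have hρ : ‖((‖z‖ / ε : ℝ) : ℂ)‖ < 1 := by
    rw [norm_real, Real.norm_eq_abs, abs_of_nonneg (by positivity), div_lt_one hε]
    exact hz
  have hsumm : Summable fun n => ‖a n‖ * (‖z‖ / ε) ^ n := by
    have := (hasSum_ascPochhammer_div_factorial_mul_pow (δ : ℂ) hρ).summable.norm
    refine this.congr fun n => ?_
    rw [norm_mul, norm_pow, norm_real, Real.norm_eq_abs, abs_of_nonneg (by positivity)]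
  have hmain := hasSum_integral_of_dominated_convergence (μ := volume)
    (F := fun (n : ℕ) s => a n * z ^ n * (k (contourParam ε μ s) *
      (contourParam ε μ s ^ n)⁻¹ * contourVelocity ε μ s))
    (f := fun s => prabhakarG α δ β (contourParam ε μ s) / shiftPow δ z (contourParam ε μ s) *
      contourVelocity ε μ s)
    (fun n s => ‖a n‖ * (‖z‖ / ε) ^ n * ‖k (contourParam ε μ s) * contourVelocity ε μ s‖)
    (fun n => ?_) (fun n => Eventually.of_forall fun s => ?_)
    (Eventually.of_forall fun s => hsumm.mul_right _) ?_ (Eventually.of_forall fun s => ?_)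
  · simp only [hterm] at hmain
    rw [← contourIntegral_eq_integral (f := fun ζ => prabhakarG α δ β ζ / shiftPow δ z ζ) hε hμ0
      (integrable_prabhakarG_div_shiftPow hα hδ hε hμ1 hμ2
      hμ (isOpen_leftRegion hμ0.le hμ.le) disjoint_leftRegion_contourSet hzU)] at hmain
    refine (hmain.mul_left (1 / (2 * (Real.pi : ℂ) * (α : ℂ) * I))).congr_fun ?_
    intro n
    have hpi : (Real.pi : ℂ) ≠ 0 := ofReal_ne_zero.2 Real.pi_ne_zero
    field_simp
  · have := (integrable_mul_contourVelocity hε (integrable_expRootMulCpow hα hε hμ1 hμ2 hμ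
      ((1 - (α * n + β)) / α - 1))).aestronglyMeasurable
    simp only [fun s => hkn n _ (hZ0 s)] at this
    exact this.const_mul _
  · have hr : ε ≤ ‖contourParam ε μ s‖ := by
      rw [norm_contourParam hε]; exact le_contourRadius s
    rw [mul_right_comm (k _), norm_mul, norm_mul (a n), norm_mul (k _ * _), norm_inv, norm_pow,
      norm_pow, div_pow, div_eq_mul_inv]
    have h1 : (‖contourParam ε μ s‖ ^ n)⁻¹ ≤ (ε ^ n)⁻¹ := by gcongr
    calc _ = ‖a n‖ * ‖z‖ ^ n * ‖k (contourParam ε μ s) * contourVelocity ε μ s‖ *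
          (‖contourParam ε μ s‖ ^ n)⁻¹ := by ring
      _ ≤ ‖a n‖ * ‖z‖ ^ n * ‖k (contourParam ε μ s) * contourVelocity ε μ s‖ * (ε ^ n)⁻¹ := by
          gcongr
      _ = _ := by ring
  · simp only [tsum_mul_right]
    exact hkW.norm.const_mul _
  · have hr : ε ≤ ‖contourParam ε μ s‖ := by
      rw [norm_contourParam hε]; exact le_contourRadius s
    have hw : ‖z / contourParam ε μ s‖ < 1 := by
      rw [norm_div, div_lt_one (hε.trans_le hr)]; exact hz.trans_le hr
    rw [prabhakarG_div_shiftPow z (hZ0 s)]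
    refine ((hasSum_ascPochhammer_div_factorial_mul_pow (δ : ℂ) hw).mul_left
      (k (contourParam ε μ s)) |>.mul_right (contourVelocity ε μ s)).congr_fun fun n => ?_
    rw [div_pow]
    ring

end

section

/-! ### The integral representations -/

variable {α δ ε μ : ℝ} {β : ℂ}

/-- Convergence comes from termwise integration over a contour of radius larger than `‖z‖`, so no
growth estimate for `Γ` is needed. -/
theorem summable_prabhakarTerm (hα : 0 < α) (hδ : 0 ≤ δ) (hμ1 : Real.pi * α / 2 < μ)
    (hμ2 : μ < α * Real.pi) (hμ : μ < Real.pi) (z : ℂ) : Summable (prabhakarTerm α β δ z) :=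
  (hasSum_prabhakarTerm (ε := ‖z‖ + 1) hα hδ (by positivity) hμ1 hμ2 hμ (lt_add_one _)).summable

theorem differentiable_prabhakar (hα : 0 < α) (hδ : 0 ≤ δ) (hμ1 : Real.pi * α / 2 < μ)
    (hμ2 : μ < α * Real.pi) (hμ : μ < Real.pi) :
    Differentiable ℂ fun z => prabhakar α β δ z := by
  intro z
  have hμ0 : 0 < μ := lt_trans (by have := Real.pi_pos; positivity) hμ1
  have hR : 0 < ‖z‖ + 1 := by positivity
  have hz : z ∈ leftRegion (‖z‖ + 1) μ := Or.inl (lt_add_one _)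
  have hd := ((differentiableOn_contourIntegral_prabhakarG_div_shiftPow (β := β) hα hδ hR hμ1 hμ2
    hμ).differentiableAt ((isOpen_leftRegion hμ0.le hμ.le).mem_nhds hz)).const_mul
    (1 / (2 * (Real.pi : ℂ) * (α : ℂ) * I))
  refine hd.congr_of_eventuallyEq ?_
  filter_upwards [(isOpen_lt continuous_norm continuous_const).mem_nhds (lt_add_one ‖z‖)] with w hw
  exact (hasSum_prabhakarTerm hα hδ hR hμ1 hμ2 hμ hw).tsum_eq

theorem prabhakar_eq_contourIntegral_shiftPow (hα : 0 < α) (hδ : 0 ≤ δ) (hε : 0 < ε)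
    (hμ1 : Real.pi * α / 2 < μ) (hμ2 : μ < α * Real.pi) (hμ : μ < Real.pi) {z : ℂ}
    (hz : z ∈ leftRegion ε μ) :
    prabhakar α β δ z = 1 / (2 * (Real.pi : ℂ) * (α : ℂ) * I) *
      contourIntegral ε μ fun ζ => prabhakarG α δ β ζ / shiftPow δ z ζ := by
  have hμ0 : 0 < μ := lt_trans (by have := Real.pi_pos; positivity) hμ1
  have hU : IsOpen (leftRegion ε μ) := isOpen_leftRegion hμ0.le hμ.le
  have hright := (differentiableOn_contourIntegral_prabhakarG_div_shiftPow (β := β) hα hδ hε hμ1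
    hμ2 hμ).const_mul (1 / (2 * (Real.pi : ℂ) * (α : ℂ) * I))
  refine ((differentiable_prabhakar hα hδ hμ1 hμ2 hμ).differentiableOn.analyticOnNhd
    hU).eqOn_of_preconnected_of_eventuallyEq (hright.analyticOnNhd hU)
    (isPreconnected_leftRegion hε) (zero_mem_leftRegion hε) ?_ hz
  filter_upwards [(isOpen_lt continuous_norm continuous_const).mem_nhds
    (show ‖(0 : ℂ)‖ < ε by simpa using hε)] with w hw
  exact (hasSum_prabhakarTerm hα hδ hε hμ1 hμ2 hμ hw).tsum_eq

/-- Along the contour, the branch `ζ^δ (1 - z/ζ)^δ` is the principal power `(ζ - z)^δ` as soon as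
`ζ - z` avoids the branch cut. -/
theorem shiftPow_eq_cpow_of_forall_mem_slitPlane (hε : 0 < ε) (hμ0 : 0 < μ) (hμ : μ < Real.pi)
    {z : ℂ} (hz : z ∈ leftRegion ε μ) (hcut : ∀ ζ ∈ contourSet ε μ, ζ - z ∈ slitPlane) (s : ℝ) :
    shiftPow δ z (contourParam ε μ s) = (contourParam ε μ s - z) ^ (δ : ℂ) := by
  have hpi := Real.pi_pos
  have hZc := contourParam_mem_contourSet hε hμ0 hμ
  have hZs := contourParam_mem_slitPlane hε hμ0 hμ
  have hZ0 := fun s => slitPlane_ne_zero (hZs s)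
  have hw := fun s => one_sub_div_mem_slitPlane_of_mem_leftRegion hε hz (hZc s)
  have hprod : ∀ s, contourParam ε μ s * (1 - z / contourParam ε μ s) = contourParam ε μ s - z :=
    fun s => by rw [mul_sub, mul_one, mul_div_cancel₀ _ (hZ0 s)]
  -- `N` is the discrepancy of the logarithms: continuous with values in `2πiℤ`, so its zero set is
  -- open and closed in `ℝ`.
  set N : ℝ → ℂ := fun s => log (contourParam ε μ s) + log (1 - z / contourParam ε μ s) -
    log (contourParam ε μ s - z) with hN
  have hcZ : Continuous (contourParam ε μ) := continuous_contourParam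
  have hNc : Continuous N :=
    ((hcZ.clog hZs).add ((continuous_const.sub (continuous_const.div hcZ hZ0)).clog hw)).sub
      ((hcZ.sub continuous_const).clog fun s => hcut _ (hZc s))
  have hexp : ∀ s, exp (N s) = 1 := fun s => by
    rw [hN]
    simp only
    rw [exp_sub, exp_add, exp_log (hZ0 s), exp_log (slitPlane_ne_zero (hw s)), hprod,
      exp_log (slitPlane_ne_zero (hcut _ (hZc s))),
      div_self (slitPlane_ne_zero (hcut _ (hZc s)))]
  have hsmall : ∀ s, ‖N s‖ < 1 → N s = 0 := by
    intro s hs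
    obtain ⟨n, hn⟩ := exp_eq_one_iff.1 (hexp s)
    rcases eq_or_ne n 0 with rfl | hn0
    · simpa using hn
    · rw [hn, norm_mul, norm_intCast] at hs
      have h1 : (1 : ℝ) ≤ |(n : ℝ)| := by exact_mod_cast Int.one_le_abs hn0
      have h2 : ‖2 * (Real.pi : ℂ) * I‖ = 2 * Real.pi := by
        simp [abs_of_pos hpi]
      rw [h2] at hs
      nlinarith [Real.pi_gt_three]
  have hclopen : IsClopen {s | N s = 0} := by
    refine ⟨isClosed_eq hNc continuous_const, ?_⟩
    have : {s | N s = 0} = {s | ‖N s‖ < 1} := by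
      ext s
      exact ⟨fun h => by simp only [mem_ofPred_eq] at h ⊢; simp [h], hsmall s⟩
    rw [this]
    exact isOpen_lt hNc.norm continuous_const
  have hne : {s | N s = 0}.Nonempty := by
    have htop : Tendsto (fun s => ‖contourParam ε μ s‖) atTop atTop := by
      simp only [norm_contourParam hε]
      refine tendsto_atTop_mono (fun s => ?_) (tendsto_atTop_add_const_right atTop (-μ) tendsto_id)
      simp only [id, contourRadius]
      linarith [le_max_left (|s| - μ) 0, le_abs_self s]
    -- Far out the argument of `1 - z/ζ` is smaller than `π - μ`; added to that of `ζ`, at most `μ`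
    -- in modulus, it stays in the principal range, so `N` vanishes there.
    have hlim : Tendsto (fun s => (1 - z / contourParam ε μ s).arg) atTop (𝓝 0) := by
      have h1 : Tendsto (fun s => 1 - z / contourParam ε μ s) atTop (𝓝 1) := by
        have h2 : Tendsto (fun s => z / contourParam ε μ s) atTop (𝓝 0) := by
          simpa [div_eq_mul_inv] using (tendsto_inv₀_cobounded.comp
            (tendsto_norm_atTop_iff_cobounded.1 htop)).const_mul z
        simpa using h2.const_sub 1
      simpa [arg_one, Function.comp_def] using
        (continuousAt_arg one_mem_slitPlane).tendsto.comp h1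
    have hev : ∀ᶠ s in atTop, |(1 - z / contourParam ε μ s).arg| < Real.pi - μ := by
      have := hlim.abs
      rw [abs_zero] at this
      exact this.eventually (gt_mem_nhds (by linarith))
    obtain ⟨s, hs⟩ := hev.exists
    refine ⟨s, ?_⟩
    have h1 := abs_contourAngle_le hμ0.le s
    rw [← arg_contourParam hε hμ0.le hμ s, abs_le] at h1
    rw [abs_lt] at hs
    have h2 := (log_mul_eq_add_log_iff (hZ0 s) (slitPlane_ne_zero (hw s))).2
      ⟨by linarith, by linarith⟩
    rw [hprod] at h2
    simp only [hN, mem_ofPred_eq, h2, sub_self]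
  have hall : N s = 0 := by
    have : s ∈ {s | N s = 0} := hclopen.eq_univ hne ▸ mem_univ s
    exact this
  have hlog : log (contourParam ε μ s - z) =
      log (contourParam ε μ s) + log (1 - z / contourParam ε μ s) := by
    rw [hN] at hall
    exact (sub_eq_zero.1 hall).symm
  rw [shiftPow, cpow_def_of_ne_zero (hZ0 s), cpow_def_of_ne_zero (slitPlane_ne_zero (hw s)),
    cpow_def_of_ne_zero (slitPlane_ne_zero (hcut _ (hZc s))), hlog, ← exp_add, add_mul]

theorem contourIntegral_congr (hε : 0 < ε) (hμ0 : 0 < μ) {f g : ℂ → ℂ}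
    (hf : Integrable fun s => f (contourParam ε μ s))
    (h : ∀ s, f (contourParam ε μ s) = g (contourParam ε μ s)) :
    ContourIntegrable ε μ g ∧ contourIntegral ε μ g = contourIntegral ε μ f := by
  have hg : Integrable fun s => g (contourParam ε μ s) :=
    hf.congr (Eventually.of_forall h)
  refine ⟨contourIntegrable_of_integrable hμ0 hg, ?_⟩
  rw [contourIntegral_eq_integral hε hμ0 hf, contourIntegral_eq_integral hε hμ0 hg]
  simp only [h]

/-- The contour of radius `‖z‖ + 1` has `z` on its left. It differs from the given one by the
boundary of a sector enclosing `z`, where the integrand has a pole of order `n`. -/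
theorem prabhakar_eq_contourIntegral_add_iteratedDeriv (hα : 0 < α) (hδ : 0 < δ) (hε : 0 < ε)
    (hμ1 : Real.pi * α / 2 < μ) (hμ2 : μ < α * Real.pi) (hμ : μ < Real.pi) {n : ℕ} (hn : δ = n)
    {z : ℂ} (hz : z ∈ rightRegion ε μ) :
    ContourIntegrable ε μ (fun ζ => prabhakarG α δ β ζ / (ζ - z) ^ n) ∧
      prabhakar α β δ z =
        1 / (2 * (Real.pi : ℂ) * (α : ℂ) * I) *
          contourIntegral ε μ (fun ζ => prabhakarG α δ β ζ / (ζ - z) ^ n) +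
        1 / ((α : ℂ) * Gamma (δ : ℂ)) * iteratedDeriv (n - 1) (prabhakarG α δ β) z := by
  have hμ0 : 0 < μ := lt_trans (by have := Real.pi_pos; positivity) hμ1
  have hshift : ∀ r : ℝ, 0 < r → ∀ s, prabhakarG α δ β (contourParam r μ s) /
      shiftPow δ z (contourParam r μ s) =
      prabhakarG α δ β (contourParam r μ s) / (contourParam r μ s - z) ^ n := fun r hr s => by
    rw [shiftPow_natCast hn z (slitPlane_ne_zero (contourParam_mem_slitPlane hr hμ0 hμ s))]
  have hint := (contourIntegral_congr (f := fun ζ => prabhakarG α δ β ζ / shiftPow δ z ζ)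
    (g := fun ζ => prabhakarG α δ β ζ / (ζ - z) ^ n) hε hμ0
    (integrable_prabhakarG_div_shiftPow hα hδ.le hε hμ1 hμ2 hμ
      (isOpen_rightRegion hε hμ0.le hμ.le) disjoint_rightRegion_contourSet hz) (hshift ε hε)).1
  refine ⟨hint, ?_⟩
  have hR : 0 < ‖z‖ + 1 := by positivity
  have hzR : z ∈ leftRegion (‖z‖ + 1) μ := Or.inl (lt_add_one _)
  have houter := (contourIntegral_congr (f := fun ζ => prabhakarG α δ β ζ / shiftPow δ z ζ)
    (g := fun ζ => prabhakarG α δ β ζ / (ζ - z) ^ n) hR hμ0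
    (integrable_prabhakarG_div_shiftPow hα hδ.le hR hμ1 hμ2 hμ
      (isOpen_leftRegion hμ0.le hμ.le) disjoint_leftRegion_contourSet hzR) (hshift _ hR)).2
  have hsub := contourIntegral_sub_contourIntegral (R := ‖z‖ + 1) (by linarith [hz.1]) hint
  rw [prabhakar_eq_contourIntegral_shiftPow hα hδ.le hR hμ1 hμ2 hμ hzR, ← houter,
    eq_add_of_sub_eq' hsub]
  -- Positivity of `δ` excludes `n = 0`, so the subtraction in `n - 1` is not truncated and `Γ(δ) =
  -- m!`.
  obtain ⟨m, rfl⟩ : ∃ m, n = m + 1 := by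
    refine Nat.exists_eq_succ_of_ne_zero ?_
    rintro rfl
    simp [hn] at hδ
  have hG : Gamma (δ : ℂ) = m.factorial := by
    rw [hn, ofReal_natCast, Nat.cast_succ, Gamma_nat_eq_factorial]
  rw [sectorIntegral_div_sub_pow hε hμ hz.1 (lt_add_one _) hz.2 m
    differentiableOn_prabhakarG, Nat.add_sub_cancel, hG]
  have hpi : (Real.pi : ℂ) ≠ 0 := ofReal_ne_zero.2 Real.pi_ne_zero
  have hα0 : (α : ℂ) ≠ 0 := ofReal_ne_zero.2 hα.ne'
  have hf : (m.factorial : ℂ) ≠ 0 := by exact_mod_cast m.factorial_ne_zero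
  field_simp

end

end

theorem theorem4p1 (α δ ε μ : ℝ) (β : ℂ) (hδ : 0 < δ) (hα0 : 0 < α) (hα2 : α < 2) (hε : 0 < ε)
    (hμ₁ : Real.pi * α / 2 < μ) (hμ₂ : μ < min Real.pi (α * Real.pi)) :
    -- the series defining the Prabhakar function converges everywhere
    (∀ z : ℂ, Summable (prabhakarTerm α β δ z)) ∧
    -- `z` to the left of the contour
    (∀ z ∈ leftRegion ε μ,
      ContourIntegrable ε μ (fun ζ => prabhakarG α δ β ζ / shiftPow δ z ζ) ∧
      prabhakar α β δ z =
        1 / (2 * (Real.pi : ℂ) * (α : ℂ) * Complex.I) *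
          contourIntegral ε μ (fun ζ => prabhakarG α δ β ζ / shiftPow δ z ζ)) ∧
    -- `z` to the left of the contour, with the principal value of `(ζ - z) ^ δ`, whenever `δ` is an
    -- integer or `ζ - z` does not meet the branch cut
    (∀ z ∈ leftRegion ε μ,
      ((∃ n : ℕ, δ = n) ∨ ∀ ζ ∈ contourSet ε μ, ζ - z ∈ Complex.slitPlane) →
      ContourIntegrable ε μ (fun ζ => prabhakarG α δ β ζ / (ζ - z) ^ (δ : ℂ)) ∧
      prabhakar α β δ z =
        1 / (2 * (Real.pi : ℂ) * (α : ℂ) * Complex.I) *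
          contourIntegral ε μ (fun ζ => prabhakarG α δ β ζ / (ζ - z) ^ (δ : ℂ))) ∧
    -- `z` to the right of the contour, `δ` a positive integer
    (∀ n : ℕ, δ = n → ∀ z ∈ rightRegion ε μ,
      ContourIntegrable ε μ (fun ζ => prabhakarG α δ β ζ / (ζ - z) ^ n) ∧
      prabhakar α β δ z =
        1 / (2 * (Real.pi : ℂ) * (α : ℂ) * Complex.I) *
          contourIntegral ε μ (fun ζ => prabhakarG α δ β ζ / (ζ - z) ^ n) +
        1 / ((α : ℂ) * Complex.Gamma (δ : ℂ)) * iteratedDeriv (n - 1) (prabhakarG α δ β) z) := by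
  have hμ : μ < Real.pi := hμ₂.trans_le (min_le_left _ _)
  have hμ' : μ < α * Real.pi := hμ₂.trans_le (min_le_right _ _)
  have hμ0 : 0 < μ := lt_trans (by have := Real.pi_pos; positivity) hμ₁
  have hint : ∀ z ∈ leftRegion ε μ, MeasureTheory.Integrable fun s =>
      prabhakarG α δ β (contourParam ε μ s) / shiftPow δ z (contourParam ε μ s) := fun z hz =>
    integrable_prabhakarG_div_shiftPow hα0 hδ.le hε hμ₁ hμ' hμ (isOpen_leftRegion hμ0.le hμ.le)
      disjoint_leftRegion_contourSet hz
  refine ⟨summable_prabhakarTerm hα0 hδ.le hμ₁ hμ' hμ, fun z hz => ⟨?_, ?_⟩, fun z hz h => ?_,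
    fun n hn z hz =>
      prabhakar_eq_contourIntegral_add_iteratedDeriv hα0 hδ hε hμ₁ hμ' hμ hn hz⟩
  · exact contourIntegrable_of_integrable
      (f := fun ζ => prabhakarG α δ β ζ / shiftPow δ z ζ) hμ0 (hint z hz)
  · exact prabhakar_eq_contourIntegral_shiftPow hα0 hδ.le hε hμ₁ hμ' hμ hz
  · have hpow : ∀ s, shiftPow δ z (contourParam ε μ s) =
        (contourParam ε μ s - z) ^ (δ : ℂ) := by
      intro s
      rcases h with ⟨n, hn⟩ | hcut
      · rw [shiftPow_natCast hn z
          (Complex.slitPlane_ne_zero (contourParam_mem_slitPlane hε hμ0 hμ s)), hn,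
          Complex.ofReal_natCast, Complex.cpow_natCast]
      · exact shiftPow_eq_cpow_of_forall_mem_slitPlane hε hμ0 hμ hz hcut s
    have hc := contourIntegral_congr (f := fun ζ => prabhakarG α δ β ζ / shiftPow δ z ζ)
      (g := fun ζ => prabhakarG α δ β ζ / (ζ - z) ^ (δ : ℂ)) hε hμ0 (hint z hz)
      (fun s => by rw [hpow s])
    exact ⟨hc.1, by
      rw [hc.2]; exact prabhakar_eq_contourIntegral_shiftPow hα0 hδ.le hε hμ₁ hμ' hμ hz⟩
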